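/- Let $H\neq 0$. For $\lambda\in\mathbb R$ let $M_\lambda(t)(x,y,z)=(x\cos t-y\sin t,\;x\sin t+y\cos t,\;z+\lambda t)$ be the helicoidal motions of pitch $\lambda$ about the $z$-axis. A *cmc-$H$ helicoid* is a smooth immersed surface $(u,v)\mapsto M_\lambda(v)\,c(u)$ in $\mathbb E^3$ ($u$ in a nonempty open interval $I$, $v\in\mathbb R$), with $(u,v)$ isothermal, whose mean curvature with respect to the orientation of $(u,v)$ is constantly $H$. Its *inner radius* is the infimum of the distances of its points to the $z$-axis. A cmc-$H$ helicoid $\mathbf y:\mathbb R^2\to\mathbb E^3$ belongs to the *associated family* of a cmc-$H$ helicoid $\mathbf x:I\times\mathbb R\to\mathbb E^3$ if there is a smooth map $\varphi:I\times\mathbb R\to\mathbb R^2$ such that $\mathbf y\circ\varphi$ and $\mathbf x$ have the same first fundamental form and the same mean curvature. Let $\mathfrak M=\{(\mu,b): 0\le\mu\le 1,\ 1\le b,\ \mu b\le 1\}$. For $(\mu,b)\in\mathfrak M$ put $c_1=\sqrt{(1-\mu^2b^2)(b^2-1)}$ and $g(u)=\frac{c_1}{b}\Pi(\mathrm{am}(bu,\mu),\mu^2b^2,\mu)$,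 where $\Pi(\varphi,n,k)=\int_0^\varphi\frac{d\theta}{(1-n\sin^2\theta)\sqrt{1-k^2\sin^2\theta}}$ and $E(\varphi,k)=\int_0^\varphi\sqrt{1-k^2\sin^2\theta}\,d\theta$ are the elliptic integrals and $\mathrm{am},\mathrm{sn},\mathrm{cn},\mathrm{dn}$ are Jacobi's functions. With $\mathbb E^3=\mathbb C\times\mathbb R$, let $\mathbf x_{\mu,b}:\mathbb R^2\to\mathbb E^3$ be given by $$-2H\,\mathbf x_{\mu,b}(u,v)=\begin{pmatrix} e^{i(v+g(u))}\Big(w+\dfrac{\mu b\,(b\,\mathrm{cn}\,\mathrm{dn}-i c_1\mathrm{sn})}{w}\Big)\\[2mm] -\mu b\,\mathrm{sn}+(b^2-1)u-bE(\mathrm{am}(bu,\mu),\mu)+c_1v\end{pmatrix},\qquad w=\sqrt{1-\mu^2b^2\mathrm{sn}^2},$$ with $\mathrm{sn},\mathrm{cn},\mathrm{dn}$ evaluated at $(bu,\mu)$; if $\mu b=1$, then $w$ is to be read as $\mathrm{cn}$, $g$ as $0$, and the quotient as $b\,\mathrm{dn}$. Then: 1. For every $(\mu,b)\in\mathfrak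 M$, $\mathbf x_{\mu,b}$ is a cmc-$H$ helicoid (of pitch $-c_1/(2H)$), and its inner radius is zero if and only if $\mu b^2=1$. 2. For every cmc-$H$ helicoid $\mathbf x$ that is not part of a circular cylinder, there is exactly one $(\mu,b)\in\mathfrak M$ with $\mu b^2=1$ such that $\mathbf x_{\mu,b}$ belongs to the associated family of $\mathbf x$. 3. For every cmc-$H$ helicoid $\mathbf x$ that is not part of a round sphere, there is $(\mu,b)\in\mathfrak M$ such that $\mathbf x_{\mu,b}$ belongs to the associated family of $\mathbf x$ and contains a straight line. If moreover $\mathbf x$ is not part of a circular cylinder, the helicoid of part 2 contains the whole $z$-axis, i.e. the screw axis. -/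

import Mathlib

open scoped ContDiff Matrix

noncomputable section

namespace CmcHelicoid

/-! ### Parametrized surfaces in Euclidean three-space

Euclidean three-space is `Fin 3 → ℝ` with the dot product `⬝ᵥ` and the cross product `crossProduct`;
its sup norm is never used. -/

/-- Euclidean three-space. -/
abbrev Vec3 : Type := Fin 3 → ℝ

/-- The partial derivative `x_u` of a map `x(u, v)`. -/
def dU (x : ℝ × ℝ → Vec3) (p : ℝ × ℝ) : Vec3 := fderiv ℝ x p (1, 0)

/-- The partial derivative `x_v` of a map `x(u, v)`. -/
def dV (x : ℝ × ℝ → Vec3) (p : ℝ × ℝ) : Vec3 := fderiv ℝ x p (0, 1)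

/-- Coefficient `E = ⟨x_u, x_u⟩` of the first fundamental form. -/
def fffE (x : ℝ × ℝ → Vec3) (p : ℝ × ℝ) : ℝ := dU x p ⬝ᵥ dU x p

/-- Coefficient `F = ⟨x_u, x_v⟩` of the first fundamental form. -/
def fffF (x : ℝ × ℝ → Vec3) (p : ℝ × ℝ) : ℝ := dU x p ⬝ᵥ dV x p

/-- Coefficient `G = ⟨x_v, x_v⟩` of the first fundamental form. -/
def fffG (x : ℝ × ℝ → Vec3) (p : ℝ × ℝ) : ℝ := dV x p ⬝ᵥ dV x p

/-- The normal vector `x_u × x_v` (not normalized). -/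
def normalVec (x : ℝ × ℝ → Vec3) (p : ℝ × ℝ) : Vec3 := crossProduct (dU x p) (dV x p)

/-- The Gauss map `(x_u × x_v) / |x_u × x_v|`. -/
def gaussMap (x : ℝ × ℝ → Vec3) (p : ℝ × ℝ) : Vec3 :=
  (√(normalVec x p ⬝ᵥ normalVec x p))⁻¹ • normalVec x p

/-- The mean curvature (half the trace of the second fundamental form `⟨d²x, n⟩`) with respect to
the orientation given by `(u, v)`. -/
def meanCurvature (x : ℝ × ℝ → Vec3) (p : ℝ × ℝ) : ℝ :=
  (fffE x p * (dV (dV x) p ⬝ᵥ gaussMap x p)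
      - 2 * fffF x p * (dV (dU x) p ⬝ᵥ gaussMap x p)
      + fffG x p * (dU (dU x) p ⬝ᵥ gaussMap x p))
    / (2 * (fffE x p * fffG x p - fffF x p ^ 2))

/-- Two surfaces `x` (with parameter domain `D`) and `y` (with parameter domain `D'`) are
*associated*: they are locally isometric with the same mean curvature. There is a smooth change of
parameters `φ : D → D'` such that `y ∘ φ` has, on `D`, the same first fundamental form and the same
mean curvature as `x`. -/
def Associated (D : Set (ℝ × ℝ)) (x : ℝ × ℝ → Vec3) (D' : Set (ℝ × ℝ)) (y : ℝ × ℝ → Vec3) : Prop :=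
  ∃ φ : ℝ × ℝ → ℝ × ℝ, ContDiffOn ℝ ∞ φ D ∧ Set.MapsTo φ D D' ∧
    ∀ p ∈ D, fffE (y ∘ φ) p = fffE x p ∧ fffF (y ∘ φ) p = fffF x p ∧ fffG (y ∘ φ) p = fffG x p ∧
      meanCurvature (y ∘ φ) p = meanCurvature x p

/-! ### Helicoidal surfaces -/

/-- The helicoidal motion `M_lam(t)` of pitch `lam` about the `z`-axis. -/
def screw (lam t : ℝ) (p : Vec3) : Vec3 :=
  ![Real.cos t * p 0 - Real.sin t * p 1, Real.sin t * p 0 + Real.cos t * p 1, p 2 + lam * t]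

/-- The helicoidal surface `(u, v) ↦ M_lam(v) c(u)` of pitch `lam` with generating curve `c`. -/
def helicoidalSurface (lam : ℝ) (c : ℝ → Vec3) (p : ℝ × ℝ) : Vec3 := screw lam p.2 (c p.1)

/-- The parameter domain `I × ℝ` of a helicoidal surface with generating curve on `I`. -/
def dom (I : Set ℝ) : Set (ℝ × ℝ) := I ×ˢ Set.univ

/-- `M_lam(v) c(u)`, `u ∈ I`, `v ∈ ℝ`, is a helicoidal surface of pitch `lam` with constant mean
curvature `H`. As usual the generating curve is chosen such that `(u, v)` is isothermal. -/
structure IsCmcHelicoid (H lam : ℝ) (I : Set ℝ) (c : ℝ → Vec3) : Prop where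
  isOpen : IsOpen I
  ordConnected : I.OrdConnected
  nonempty : I.Nonempty
  smooth : ContDiffOn ℝ ∞ c I
  immersion : ∀ p ∈ dom I, normalVec (helicoidalSurface lam c) p ≠ 0
  isothermal : ∀ p ∈ dom I, fffE (helicoidalSurface lam c) p = fffG (helicoidalSurface lam c) p ∧
    fffF (helicoidalSurface lam c) p = 0
  cmc : ∀ p ∈ dom I, meanCurvature (helicoidalSurface lam c) p = H

/-- The point set in space traced out by a helicoidal surface. -/
def trace (lam : ℝ) (I : Set ℝ) (c : ℝ → Vec3) : Set Vec3 := helicoidalSurface lam c '' dom I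

/-- The inner radius about the `z`-axis: the infimum of the distances of the points to the axis. -/
def innerRadius (S : Set Vec3) : ℝ := sInf ((fun p : Vec3 => √(p 0 ^ 2 + p 1 ^ 2)) '' S)

/-- `S` is part of a circular cylinder about the `z`-axis. (A helicoidal surface about the `z`-axis
that lies on some circular cylinder lies on one about the `z`-axis.) -/
def InCircularCylinder (S : Set Vec3) : Prop := ∃ r : ℝ, 0 < r ∧ ∀ p ∈ S, p 0 ^ 2 + p 1 ^ 2 = r ^ 2

/-- `S` is part of a round sphere. -/
def InSphere (S : Set Vec3) : Prop :=
  ∃ (a : Vec3) (r : ℝ), 0 < r ∧ ∀ p ∈ S, (p - a) ⬝ᵥ (p - a) = r ^ 2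

/-- `S` contains a (whole) straight line. -/
def ContainsLine (S : Set Vec3) : Prop := ∃ a d : Vec3, d ≠ 0 ∧ ∀ t : ℝ, a + t • d ∈ S

/-- `S` contains the `z`-axis, the axis of all helicoidal motions considered. -/
def ContainsAxis (S : Set Vec3) : Prop := ∀ t : ℝ, (![0, 0, t] : Vec3) ∈ S

/-! ### Elliptic integrals and Jacobi elliptic functions of modulus `k ∈ [0, 1]` -/

/-- Incomplete elliptic integral of the first kind. -/
def ellipticF (φ k : ℝ) : ℝ := ∫ θ in (0 : ℝ)..φ, 1 / √(1 - k ^ 2 * Real.sin θ ^ 2)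

/-- Incomplete elliptic integral of the second kind. -/
def ellipticE (φ k : ℝ) : ℝ := ∫ θ in (0 : ℝ)..φ, √(1 - k ^ 2 * Real.sin θ ^ 2)

/-- Incomplete elliptic integral of the third kind. -/
def ellipticPi (φ n k : ℝ) : ℝ :=
  ∫ θ in (0 : ℝ)..φ, 1 / ((1 - n * Real.sin θ ^ 2) * √(1 - k ^ 2 * Real.sin θ ^ 2))

/-- Jacobi amplitude: the inverse function of `φ ↦ F(φ, k)`, which is an increasing bijection onto
`ℝ` from `ℝ` if `0 ≤ k < 1`, and from `(-π/2, π/2)` if `k = 1`. -/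
def am (u k : ℝ) : ℝ :=
  Function.invFunOn (fun φ => ellipticF φ k) {φ : ℝ | k = 1 → |φ| < Real.pi / 2} u

/-- Jacobi `sn`. -/
def sn (u k : ℝ) : ℝ := Real.sin (am u k)

/-- Jacobi `cn`. -/
def cn (u k : ℝ) : ℝ := Real.cos (am u k)

/-- Jacobi `dn`. -/
def dn (u k : ℝ) : ℝ := √(1 - k ^ 2 * sn u k ^ 2)

/-! ### The explicit two-parameter family -/

/-- The parameter space `𝔐 = {(μ, b) : 0 ≤ μ ≤ 1, 1 ≤ b, μ b ≤ 1}`. -/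
def paramSet : Set (ℝ × ℝ) := {q | 0 ≤ q.1 ∧ q.1 ≤ 1 ∧ 1 ≤ q.2 ∧ q.1 * q.2 ≤ 1}

/-- `c₁ = √((1 - μ² b²)(b² - 1))`. -/
def cOne (q : ℝ × ℝ) : ℝ := √((1 - q.1 ^ 2 * q.2 ^ 2) * (q.2 ^ 2 - 1))

/-- The angle `g(u) = (c₁ / b) Π(am(bu, μ), μ² b², μ)`. -/
def angle (q : ℝ × ℝ) (u : ℝ) : ℝ :=
  cOne q / q.2 * ellipticPi (am (q.2 * u) q.1) (q.1 ^ 2 * q.2 ^ 2) q.1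

/-- The horizontal component (in `ℂ`) of the Gauss map along the generating curve, before rotation
by `g`. For `μ b = 1` the square root `√(1 - sn²)` stands for the smooth branch `cn`. -/
def normalHor (q : ℝ × ℝ) (u : ℝ) : ℝ :=
  if q.1 * q.2 = 1 then cn (q.2 * u) q.1
  else √(1 - q.1 ^ 2 * q.2 ^ 2 * sn (q.2 * u) q.1 ^ 2)

/-- The horizontal component of the companion curve: `μ b (b cn dn - i c₁ sn) / normalHor`,
which is `b dn` for `μ b = 1` (where `c₁ = 0` and `normalHor = cn`). -/
def companionHor (q : ℝ × ℝ) (u : ℝ) : ℂ :=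
  if q.1 * q.2 = 1 then ((q.2 * dn (q.2 * u) q.1 : ℝ) : ℂ)
  else ((q.1 * q.2 : ℝ) : ℂ) *
    (((q.2 * cn (q.2 * u) q.1 * dn (q.2 * u) q.1 : ℝ) : ℂ)
      - Complex.I * ((cOne q * sn (q.2 * u) q.1 : ℝ) : ℂ)) / ((normalHor q u : ℝ) : ℂ)

/-- The horizontal component of `-2H` times the generating curve. -/
def profileHor (q : ℝ × ℝ) (u : ℝ) : ℂ :=
  Complex.exp (Complex.I * (angle q u : ℂ)) * ((normalHor q u : ℂ) + companionHor q u)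

/-- The vertical component of `-2H` times the generating curve. -/
def profileVert (q : ℝ × ℝ) (u : ℝ) : ℝ :=
  -(q.1 * q.2 * sn (q.2 * u) q.1)
    + ((q.2 ^ 2 - 1) * u - q.2 * ellipticE (am (q.2 * u) q.1) q.1)

/-- The generating curve of the cmc-`H` helicoid with parameters `q = (μ, b)`. -/
def genCurve (H : ℝ) (q : ℝ × ℝ) (u : ℝ) : Vec3 :=
  (-1 / (2 * H)) • ![(profileHor q u).re, (profileHor q u).im, profileVert q u]

/-- The pitch of the cmc-`H` helicoid with parameters `q = (μ, b)`. -/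
def pitch (H : ℝ) (q : ℝ × ℝ) : ℝ := -1 / (2 * H) * cOne q

/-- The cmc-`H` helicoid with parameters `q = (μ, b)`, parametrized over `ℝ × ℝ`. -/
def helicoid (H : ℝ) (q : ℝ × ℝ) : ℝ × ℝ → Vec3 := helicoidalSurface (pitch H q) (genCurve H q)

/-- The cmc-`H` helicoid with parameters `q` belongs to the associated family of the helicoidal
surface `M_lam(v) c(u)`, `u ∈ I`. -/
def InAssociatedFamily (H : ℝ) (q : ℝ × ℝ) (lam : ℝ) (I : Set ℝ) (c : ℝ → Vec3) : Prop :=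
  q ∈ paramSet ∧ Associated (dom I) (helicoidalSurface lam c) Set.univ (helicoid H q)

end CmcHelicoid

end

/-! A helicoidal surface in isothermal parameters has metric `ρ(u)(du² + dv²)` with `ρ = |c_hor|² +
λ²`, and constant mean curvature turns into the vector equation `Δx = 2H x_u × x_v` (`laplace_eq`).
Its vertical component integrates to `z' = Hρ + a` (`exists_flux`). Eliminating the remaining
coordinates leaves `ρ'² = 4Cρ² - 4H²ρ³ - 4kρ` with `C = 1 - 2aH` and `k = a² + λ²`, together with
its second-order form (`isProfile`). So up to translation in `u` the metric depends on `(C, k)`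
only.

For the explicit surfaces `ρ = (b(dn + μ cn) / 2H)²`, hence `C = b²(1 + μ²)/2` and `k = b⁴(1 -
μ²)²/(16H²)`. A homothety of the parameter plane with ratio `κ` multiplies `C` by `κ²` and `k` by
`κ⁴`. The quotient `4H²k/C² = ((1 - μ²)/(1 + μ²))²` sees only `μ`, and `b` is absorbed by `κ`. Since
the energy equation forces `C ≥ 2|H|√k`, every profile determines some `μ ∈ [0, 1]`
(`exists_modulus`), and every `x_{μ,b}` with this `μ` is associated to the given surface
(`associated_of_profile`). If `μ > 0`, the choice `b = 1/√μ` achieves `μb² = 1`. If `μ = 0`, `ρ` is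
constant and the surface is a cylinder; if `k = 0`, it is a sphere.

Uniqueness requires that any local isometry, not only a homothety, preserve `k/C²`
(`invariant_of_associated`). After a possible reflection it is a holomorphic map `f` with `ρ(Re z) =
σ(Re f)|f'|²`. Comparing Laplacians of logarithms gives `k = k₂|f'|⁴`. So `|f'|` is constant unless
`k₂ = 0`, and then the energies give `C = |f'|²C₂`.

That the explicit surfaces have mean curvature `H` rests on a linear system for the two rotated
horizontal components `gaussHor` and `compHor` (`hasDerivAt_gaussHor`, `hasDerivAt_compHor`) and on
their quadratic relations. The same relations give the distance to the axis, whose square is bounded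
below by `(1 - μb²)²/(4H²)`. For `μb² = 1` and `μ < 1` the curve meets the axis where `am = π`, and
the screw motion, of nonzero pitch, sweeps out the whole axis. -/

noncomputable section

namespace CmcHelicoid

/-! ### Elliptic integrals and Jacobi's functions -/

open Set in
theorem hasDerivAt_integral_of_continuousOn {f : ℝ → ℝ} {D : Set ℝ} (hD : IsOpen D)
    (hoc : D.OrdConnected) (h0 : (0 : ℝ) ∈ D) (hf : ContinuousOn f D) {x : ℝ} (hx : x ∈ D) :
    HasDerivAt (fun y => ∫ θ in (0 : ℝ)..y, f θ) (f x) x := by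
  apply intervalIntegral.integral_hasDerivAt_right
  · exact (hf.mono (hoc.uIcc_subset h0 hx)).intervalIntegrable
  · exact hf.stronglyMeasurableAtFilter hD x hx
  · exact hf.continuousAt (hD.mem_nhds hx)

/-- The domain on which `F(·, k)` is inverted by the amplitude. -/
def amDom (k : ℝ) : Set ℝ := {φ : ℝ | k = 1 → |φ| < Real.pi / 2}

theorem amDom_one : amDom 1 = Set.Ioo (-(Real.pi / 2)) (Real.pi / 2) := by
  ext x; simp [amDom, abs_lt]

theorem amDom_of_ne_one {k : ℝ} (hk : k ≠ 1) : amDom k = Set.univ := by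
  ext x; simp [amDom, hk]

theorem isOpen_amDom (k : ℝ) : IsOpen (amDom k) := by
  by_cases hk : k = 1
  · subst hk; rw [amDom_one]; exact isOpen_Ioo
  · rw [amDom_of_ne_one hk]; exact isOpen_univ

theorem ordConnected_amDom (k : ℝ) : (amDom k).OrdConnected := by
  by_cases hk : k = 1
  · subst hk; rw [amDom_one]; exact Set.ordConnected_Ioo
  · rw [amDom_of_ne_one hk]; exact Set.ordConnected_univ

theorem zero_mem_amDom (k : ℝ) : (0 : ℝ) ∈ amDom k := by
  intro _; simp [Real.pi_pos]

theorem radicand_pos {k φ : ℝ} (hk0 : 0 ≤ k) (hk1 : k ≤ 1) (hφ : φ ∈ amDom k) :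
    0 < 1 - k ^ 2 * Real.sin φ ^ 2 := by
  by_cases hk : k = 1
  · subst hk
    rw [amDom_one] at hφ
    have := Real.cos_pos_of_mem_Ioo hφ
    nlinarith [Real.sin_sq_add_cos_sq φ]
  · have h1 : k < 1 := lt_of_le_of_ne hk1 hk
    have h2 : k ^ 2 < 1 := by nlinarith
    nlinarith [Real.sin_sq_le_one φ, sq_nonneg k, sq_nonneg (Real.sin φ)]

section Amplitude

variable {k : ℝ} (hk0 : 0 ≤ k) (hk1 : k ≤ 1)
include hk0 hk1

theorem hasDerivAt_ellipticF {φ : ℝ} (hφ : φ ∈ amDom k) :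
    HasDerivAt (fun φ => ellipticF φ k) (1 / √(1 - k ^ 2 * Real.sin φ ^ 2)) φ := by
  refine hasDerivAt_integral_of_continuousOn (f := fun θ => 1 / √(1 - k ^ 2 * Real.sin θ ^ 2))
    (isOpen_amDom k) (ordConnected_amDom k) (zero_mem_amDom k) ?_ hφ
  refine ContinuousOn.div (by fun_prop) (by fun_prop) fun x hx => ?_
  exact (Real.sqrt_pos.2 (radicand_pos hk0 hk1 hx)).ne'

theorem strictMonoOn_ellipticF : StrictMonoOn (fun φ => ellipticF φ k) (amDom k) := by
  apply strictMonoOn_of_deriv_pos (ordConnected_amDom k).convex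
  · exact fun x hx => (hasDerivAt_ellipticF hk0 hk1 hx).continuousAt.continuousWithinAt
  · intro x hx
    rw [(isOpen_amDom k).interior_eq] at hx
    rw [(hasDerivAt_ellipticF hk0 hk1 hx).deriv]
    exact one_div_pos.2 (Real.sqrt_pos.2 (radicand_pos hk0 hk1 hx))

omit hk0 hk1 in
-- For modulus 1 the inverse of `F` is the Gudermannian function `t ↦ arctan (sinh t)`, because the
-- derivative of the composite is 1.
theorem surjOn_ellipticF_one : Set.SurjOn (fun φ => ellipticF φ 1) (amDom 1) Set.univ := by
  intro u _
  have hmem : ∀ t, Real.arctan (Real.sinh t) ∈ amDom 1 := fun t => by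
    rw [amDom_one]; exact ⟨Real.neg_pi_div_two_lt_arctan _, Real.arctan_lt_pi_div_two _⟩
  have hd : ∀ t, HasDerivAt (fun t => ellipticF (Real.arctan (Real.sinh t)) 1) 1 t := by
    intro t
    have h1 := hasDerivAt_ellipticF zero_le_one le_rfl (hmem t)
    have h2 : HasDerivAt (fun t => Real.arctan (Real.sinh t))
        (1 / (1 + Real.sinh t ^ 2) * Real.cosh t) t := (Real.hasDerivAt_sinh t).arctan
    refine (h1.comp t h2).congr_deriv ?_
    have hc := Real.cosh_pos t
    have h3 : 1 + Real.sinh t ^ 2 = Real.cosh t ^ 2 := by rw [Real.cosh_sq]; ring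
    have h4 : 1 - 1 ^ 2 * Real.sin (Real.arctan (Real.sinh t)) ^ 2 = (1 / Real.cosh t) ^ 2 := by
      have := Real.cos_sq_arctan (Real.sinh t)
      rw [h3] at this
      rw [div_pow, one_pow, ← this, Real.cos_sq']; ring
    rw [h4, Real.sqrt_sq (by positivity), h3]
    field_simp
  have hc : ∀ t, ellipticF (Real.arctan (Real.sinh t)) 1 - t = 0 := by
    intro t
    have h5 : ∀ s, HasDerivAt (fun t => ellipticF (Real.arctan (Real.sinh t)) 1 - t) 0 s :=
      fun s => ((hd s).sub (hasDerivAt_id s)).congr_deriv (sub_self 1)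
    have := is_const_of_deriv_eq_zero (fun s => (h5 s).differentiableAt) (fun s => (h5 s).deriv) t 0
    rw [this]; simp [ellipticF]
  exact ⟨_, hmem u, sub_eq_zero.1 (hc u)⟩

theorem surjOn_ellipticF : Set.SurjOn (fun φ => ellipticF φ k) (amDom k) Set.univ := by
  by_cases hk : k = 1
  · subst hk; exact surjOn_ellipticF_one
  have hmem : ∀ t, t ∈ amDom k := fun t => by rw [amDom_of_ne_one hk]; trivial
  have hd := fun t => hasDerivAt_ellipticF hk0 hk1 (hmem t)
  -- The integrand is at least 1, so `F(t) - t` is monotone; hence `F` takes values beyond `±|u|` at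
  -- `±|u|`.
  have hmono : Monotone (fun t => ellipticF t k - t) := by
    have h5 : ∀ s, HasDerivAt (fun t => ellipticF t k - t) _ s :=
      fun s => (hd s).sub (hasDerivAt_id s)
    refine monotone_of_deriv_nonneg (fun s => (h5 s).differentiableAt) fun s => ?_
    rw [(h5 s).deriv]
    have hp := radicand_pos hk0 hk1 (hmem s)
    rw [sub_nonneg, le_div_iff₀ (Real.sqrt_pos.2 hp), one_mul]
    refine Real.sqrt_le_one.2 ?_
    nlinarith [mul_nonneg (sq_nonneg k) (sq_nonneg (Real.sin s))]
  have hz : ellipticF 0 k = 0 := by simp [ellipticF]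
  intro u _
  have h1 := hmono (abs_nonneg u)
  have h2 := hmono (neg_nonpos.2 (abs_nonneg u))
  simp only [hz] at h1 h2
  obtain ⟨x, -, hx⟩ := intermediate_value_Icc (f := fun φ => ellipticF φ k)
    (show -|u| ≤ |u| by linarith [abs_nonneg u])
    (fun t _ => (hd t).continuousAt.continuousWithinAt)
    (show u ∈ _ from ⟨by linarith [neg_abs_le u], by linarith [le_abs_self u]⟩)
  exact ⟨x, hmem x, hx⟩

theorem am_mem (u : ℝ) : am u k ∈ amDom k :=
  Function.invFunOn_mem (surjOn_ellipticF hk0 hk1 (Set.mem_univ u))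

theorem ellipticF_am (u : ℝ) : ellipticF (am u k) k = u :=
  Function.invFunOn_eq (surjOn_ellipticF hk0 hk1 (Set.mem_univ u))

theorem am_ellipticF {φ : ℝ} (hφ : φ ∈ amDom k) : am (ellipticF φ k) k = φ :=
  (strictMonoOn_ellipticF hk0 hk1).injOn (am_mem hk0 hk1 _) hφ (ellipticF_am hk0 hk1 _)

theorem strictMono_am : StrictMono (fun u => am u k) := by
  intro u v huv
  rw [← (strictMonoOn_ellipticF hk0 hk1).lt_iff_lt (am_mem hk0 hk1 u) (am_mem hk0 hk1 v)]
  simpa only [ellipticF_am hk0 hk1] using huv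

theorem continuous_am : Continuous (fun u => am u k) := by
  rw [continuous_iff_continuousAt]
  intro u
  apply ((strictMono_am hk0 hk1).strictMonoOn Set.univ).continuousAt_of_image_mem_nhds
    Filter.univ_mem
  refine Filter.mem_of_superset ((isOpen_amDom k).mem_nhds (am_mem hk0 hk1 u)) fun φ hφ => ?_
  exact ⟨_, trivial, am_ellipticF hk0 hk1 hφ⟩

theorem dn_pos (u : ℝ) : 0 < dn u k := Real.sqrt_pos.2 (radicand_pos hk0 hk1 (am_mem hk0 hk1 u))

theorem dn_sq (u : ℝ) : dn u k ^ 2 = 1 - k ^ 2 * sn u k ^ 2 :=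
  Real.sq_sqrt (radicand_pos hk0 hk1 (am_mem hk0 hk1 u)).le

omit hk0 hk1 in
theorem cn_sq (u : ℝ) : cn u k ^ 2 = 1 - sn u k ^ 2 := Real.cos_sq' _

theorem hasDerivAt_am (u : ℝ) : HasDerivAt (fun u => am u k) (dn u k) u := by
  have h := HasDerivAt.of_local_left_inverse (continuous_am hk0 hk1).continuousAt
    (hasDerivAt_ellipticF hk0 hk1 (am_mem hk0 hk1 u))
    (one_div_pos.2 (dn_pos hk0 hk1 u)).ne'
    (Filter.Eventually.of_forall fun y => ellipticF_am hk0 hk1 y)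
  rwa [one_div, inv_inv] at h

theorem hasDerivAt_sn (u : ℝ) : HasDerivAt (fun u => sn u k) (cn u k * dn u k) u :=
  (hasDerivAt_am hk0 hk1 u).sin

theorem hasDerivAt_cn (u : ℝ) : HasDerivAt (fun u => cn u k) (-sn u k * dn u k) u :=
  (hasDerivAt_am hk0 hk1 u).cos

theorem hasDerivAt_dn (u : ℝ) : HasDerivAt (fun u => dn u k) (-k ^ 2 * sn u k * cn u k) u := by
  have hd := dn_pos hk0 hk1 u
  have h := ((((hasDerivAt_sn hk0 hk1 u).pow 2).const_mul (k ^ 2)).const_sub 1).sqrt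
    (radicand_pos hk0 hk1 (am_mem hk0 hk1 u)).ne'
  refine h.congr_deriv ?_
  change _ / (2 * dn u k) = _
  field_simp
  ring

/-- Bootstrapping: `am' = √(1 - k² sin² am)` is as smooth as `am` itself, since the radicand stays
positive. -/
theorem contDiff_am : ContDiff ℝ ∞ (fun u => am u k) := by
  rw [contDiff_infty]
  intro n
  induction n with
  | zero => exact contDiff_zero.2 (continuous_am hk0 hk1)
  | succ n ih =>
    rw [Nat.cast_succ, contDiff_succ_iff_deriv]
    refine ⟨fun u => (hasDerivAt_am hk0 hk1 u).differentiableAt, by simp, ?_⟩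
    rw [show deriv (fun u => am u k) = fun u => √(1 - k ^ 2 * Real.sin (am u k) ^ 2) from
      funext fun u => (hasDerivAt_am hk0 hk1 u).deriv]
    exact (contDiff_const.sub (contDiff_const.mul (ih.sin.pow 2))).sqrt
      fun u => (radicand_pos hk0 hk1 (am_mem hk0 hk1 u)).ne'

theorem contDiff_sn : ContDiff ℝ ∞ (fun u => sn u k) := (contDiff_am hk0 hk1).sin

theorem hasDerivAt_ellipticE_am (u : ℝ) :
    HasDerivAt (fun u => ellipticE (am u k) k) (dn u k ^ 2) u := by
  have h := hasDerivAt_integral_of_continuousOn (f := fun θ => √(1 - k ^ 2 * Real.sin θ ^ 2))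
    isOpen_univ Set.ordConnected_univ trivial (by fun_prop) (Set.mem_univ (am u k))
  exact (h.comp u (hasDerivAt_am hk0 hk1 u)).congr_deriv (sq _).symm

theorem hasDerivAt_ellipticPi_am {n : ℝ} (hn : n < 1) (u : ℝ) :
    HasDerivAt (fun u => ellipticPi (am u k) n k) (1 / (1 - n * sn u k ^ 2)) u := by
  have hpos : ∀ θ, 0 < 1 - n * Real.sin θ ^ 2 := fun θ => by
    rcases le_or_gt n 0 with h0 | h0 <;>
      nlinarith [Real.sin_sq_le_one θ, sq_nonneg (Real.sin θ)]
  have h := hasDerivAt_integral_of_continuousOn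
    (f := fun θ => 1 / ((1 - n * Real.sin θ ^ 2) * √(1 - k ^ 2 * Real.sin θ ^ 2)))
    (isOpen_amDom k) (ordConnected_amDom k) (zero_mem_amDom k)
    (ContinuousOn.div (by fun_prop) (by fun_prop) fun x hx =>
      (mul_pos (hpos x) (Real.sqrt_pos.2 (radicand_pos hk0 hk1 hx))).ne') (am_mem hk0 hk1 u)
  refine (h.comp u (hasDerivAt_am hk0 hk1 u)).congr_deriv ?_
  change 1 / ((1 - n * sn u k ^ 2) * dn u k) * dn u k = _
  have := dn_pos hk0 hk1 u
  have := hpos (am u k)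
  change 0 < 1 - n * sn u k ^ 2 at this
  field_simp

/-- `(dn + k cn)(dn - k cn) = 1 - k²` and `dn + k cn > 0`. -/
theorem dn_add_cn_pos (u : ℝ) : 0 < dn u k + k * cn u k := by
  have hd := dn_pos hk0 hk1 u
  by_cases hk : k = 1
  · subst hk
    have h := am_mem hk0 hk1 u
    rw [amDom_one] at h
    have hc : 0 < cn u 1 := Real.cos_pos_of_mem_Ioo h
    linarith
  · have h1 : k ^ 2 < 1 := by
      have : k < 1 := lt_of_le_of_ne hk1 hk
      nlinarith
    have h2 := dn_sq hk0 hk1 u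
    have h3 := cn_sq (k := k) u
    by_contra hcon
    nlinarith

end Amplitude

/-! ### Partial derivatives of helicoidal surfaces -/

theorem dU_eq {X : ℝ × ℝ → Vec3} {p : ℝ × ℝ} (hX : DifferentiableAt ℝ X p) {d : Vec3}
    (hd : HasDerivAt (fun t => X (t, p.2)) d p.1) : dU X p = d := by
  have h : HasDerivAt (fun t : ℝ => (t, p.2)) ((1 : ℝ), (0 : ℝ)) p.1 :=
    (hasDerivAt_id _).prodMk (hasDerivAt_const _ _)
  exact (HasFDerivAt.comp_hasDerivAt (f := fun t : ℝ => (t, p.2)) p.1 hX.hasFDerivAt h).unique hd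

theorem dV_eq {X : ℝ × ℝ → Vec3} {p : ℝ × ℝ} (hX : DifferentiableAt ℝ X p) {d : Vec3}
    (hd : HasDerivAt (fun t => X (p.1, t)) d p.2) : dV X p = d := by
  have h : HasDerivAt (fun t : ℝ => (p.1, t)) ((0 : ℝ), (1 : ℝ)) p.2 :=
    (hasDerivAt_const _ _).prodMk (hasDerivAt_id _)
  exact (HasFDerivAt.comp_hasDerivAt (f := fun t : ℝ => (p.1, t)) p.2 hX.hasFDerivAt h).unique hd

/-- The velocity field of the screw motion of pitch `lam`. -/
def axisField (lam : ℝ) (p : Vec3) : Vec3 := ![-p 1, p 0, lam]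

/-- `screw 0 v` is the rotation part of the screw motion. Being an isometry, it drops out of all dot
products, so the geometry at `(u, v)` reduces to that of the generating curve at `u`. -/
theorem screw_zero_dot (v : ℝ) (a b : Vec3) : screw 0 v a ⬝ᵥ screw 0 v b = a ⬝ᵥ b := by
  simp only [screw, dotProduct, Fin.sum_univ_three, Matrix.cons_val]
  linear_combination (a 0 * b 0 + a 1 * b 1) * Real.sin_sq_add_cos_sq v

theorem screw_zero_cross (v : ℝ) (a b : Vec3) :
    crossProduct (screw 0 v a) (screw 0 v b) = screw 0 v (crossProduct a b) := by
  ext i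
  fin_cases i <;> simp only [screw, cross_apply, Matrix.cons_val, Fin.zero_eta, Fin.mk_one,
    Fin.reduceFinMk]
  · ring
  · ring
  · linear_combination (a 0 * b 1 - a 1 * b 0) * Real.sin_sq_add_cos_sq v

theorem differentiableAt_helicoidalSurface (lam : ℝ) {c : ℝ → Vec3} {p : ℝ × ℝ}
    (hc : DifferentiableAt ℝ c p.1) : DifferentiableAt ℝ (helicoidalSurface lam c) p := by
  have h : ∀ i, DifferentiableAt ℝ (fun p : ℝ × ℝ => c p.1 i) p := fun i =>
    ((differentiableAt_pi.1 hc i).comp p differentiableAt_fst :)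
  have h0 := h 0
  have h1 := h 1
  have h2 := h 2
  rw [differentiableAt_pi]
  intro i
  fin_cases i <;> simp only [helicoidalSurface, screw, Matrix.cons_val, Fin.zero_eta, Fin.mk_one,
    Fin.reduceFinMk] <;> fun_prop

theorem dU_helicoidalSurface (lam : ℝ) {c : ℝ → Vec3} {p : ℝ × ℝ} {c' : Vec3}
    (hc : HasDerivAt c c' p.1) : dU (helicoidalSurface lam c) p = screw 0 p.2 c' := by
  refine dU_eq (differentiableAt_helicoidalSurface lam hc.differentiableAt) ?_
  have h := hasDerivAt_pi.1 hc
  rw [hasDerivAt_pi]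
  intro i
  fin_cases i <;> simp only [helicoidalSurface, screw, Matrix.cons_val, Fin.zero_eta, Fin.mk_one,
    Fin.reduceFinMk]
  · exact ((h 0).const_mul _).sub ((h 1).const_mul _)
  · exact ((h 0).const_mul _).add ((h 1).const_mul _)
  · simpa using (h 2).add_const (lam * p.2)

theorem dV_helicoidalSurface (lam : ℝ) {c : ℝ → Vec3} {p : ℝ × ℝ}
    (hc : DifferentiableAt ℝ c p.1) :
    dV (helicoidalSurface lam c) p = screw 0 p.2 (axisField lam (c p.1)) := by
  refine dV_eq (differentiableAt_helicoidalSurface lam hc) ?_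
  have hcos := Real.hasDerivAt_cos p.2
  have hsin := Real.hasDerivAt_sin p.2
  rw [hasDerivAt_pi]
  intro i
  fin_cases i <;> simp only [helicoidalSurface, screw, axisField, Matrix.cons_val, Fin.zero_eta,
    Fin.mk_one, Fin.reduceFinMk]
  · exact ((hcos.mul_const (c p.1 0)).sub (hsin.mul_const (c p.1 1))).congr_deriv (by ring)
  · exact ((hsin.mul_const (c p.1 0)).add (hcos.mul_const (c p.1 1))).congr_deriv (by ring)
  · exact (((hasDerivAt_id p.2).const_mul lam).const_add (c p.1 2)).congr_deriv (by ring)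

section SmoothCurve

variable {lam : ℝ} {I : Set ℝ} {c : ℝ → Vec3} (hI : IsOpen I) (hc : ContDiffOn ℝ ∞ c I)
include hI hc

theorem hasDerivAt_curve {u : ℝ} (hu : u ∈ I) : HasDerivAt c (deriv c u) u :=
  ((hc.differentiableOn (by simp)).differentiableAt (hI.mem_nhds hu)).hasDerivAt

theorem hasDerivAt_deriv_curve {u : ℝ} (hu : u ∈ I) :
    HasDerivAt (deriv c) (deriv (deriv c) u) u :=
  hasDerivAt_curve hI (hc.deriv_of_isOpen hI (m := ∞) le_rfl) hu

omit hc in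
theorem isOpen_dom : IsOpen (dom I) := hI.prod isOpen_univ

theorem dU_helicoid {p : ℝ × ℝ} (hp : p ∈ dom I) :
    dU (helicoidalSurface lam c) p = screw 0 p.2 (deriv c p.1) :=
  dU_helicoidalSurface lam (hasDerivAt_curve hI hc hp.1)

theorem dV_helicoid {p : ℝ × ℝ} (hp : p ∈ dom I) :
    dV (helicoidalSurface lam c) p = screw 0 p.2 (axisField lam (c p.1)) :=
  dV_helicoidalSurface lam (hasDerivAt_curve hI hc hp.1).differentiableAt

theorem dU_helicoid_eventuallyEq {p : ℝ × ℝ} (hp : p ∈ dom I) :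
    dU (helicoidalSurface lam c) =ᶠ[nhds p] helicoidalSurface 0 (deriv c) := by
  filter_upwards [(isOpen_dom hI).mem_nhds hp] with p' hp'
  exact dU_helicoid hI hc hp'

theorem dV_helicoid_eventuallyEq {p : ℝ × ℝ} (hp : p ∈ dom I) :
    dV (helicoidalSurface lam c) =ᶠ[nhds p] helicoidalSurface 0 (fun u => axisField lam (c u)) := by
  filter_upwards [(isOpen_dom hI).mem_nhds hp] with p' hp'
  exact dV_helicoid hI hc hp'

theorem dU_dU_helicoid {p : ℝ × ℝ} (hp : p ∈ dom I) :
    dU (dU (helicoidalSurface lam c)) p = screw 0 p.2 (deriv (deriv c) p.1) := by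
  rw [dU, (dU_helicoid_eventuallyEq hI hc hp).fderiv_eq]
  exact dU_helicoidalSurface 0 (hasDerivAt_deriv_curve hI hc hp.1)

theorem dV_dU_helicoid {p : ℝ × ℝ} (hp : p ∈ dom I) :
    dV (dU (helicoidalSurface lam c)) p = screw 0 p.2 (axisField 0 (deriv c p.1)) := by
  rw [dV, (dU_helicoid_eventuallyEq hI hc hp).fderiv_eq]
  exact dV_helicoidalSurface 0 (hasDerivAt_deriv_curve hI hc hp.1).differentiableAt

theorem dV_dV_helicoid {p : ℝ × ℝ} (hp : p ∈ dom I) :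
    dV (dV (helicoidalSurface lam c)) p =
      screw 0 p.2 (axisField 0 (axisField lam (c p.1))) := by
  rw [dV, (dV_helicoid_eventuallyEq hI hc hp).fderiv_eq]
  have h := hasDerivAt_pi.1 (hasDerivAt_curve hI hc hp.1)
  refine dV_helicoidalSurface 0 (differentiableAt_pi.2 fun i => ?_)
  fin_cases i
  · exact (h 1).differentiableAt.neg
  · exact (h 0).differentiableAt
  · exact differentiableAt_const lam

theorem fffE_helicoid {p : ℝ × ℝ} (hp : p ∈ dom I) :
    fffE (helicoidalSurface lam c) p = deriv c p.1 ⬝ᵥ deriv c p.1 := by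
  rw [fffE, dU_helicoid hI hc hp, screw_zero_dot]

theorem fffF_helicoid {p : ℝ × ℝ} (hp : p ∈ dom I) :
    fffF (helicoidalSurface lam c) p = deriv c p.1 ⬝ᵥ axisField lam (c p.1) := by
  rw [fffF, dU_helicoid hI hc hp, dV_helicoid hI hc hp, screw_zero_dot]

theorem fffG_helicoid {p : ℝ × ℝ} (hp : p ∈ dom I) :
    fffG (helicoidalSurface lam c) p = axisField lam (c p.1) ⬝ᵥ axisField lam (c p.1) := by
  rw [fffG, dV_helicoid hI hc hp, screw_zero_dot]

theorem normalVec_helicoid {p : ℝ × ℝ} (hp : p ∈ dom I) :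
    normalVec (helicoidalSurface lam c) p =
      screw 0 p.2 (crossProduct (deriv c p.1) (axisField lam (c p.1))) := by
  rw [normalVec, dU_helicoid hI hc hp, dV_helicoid hI hc hp, screw_zero_cross]

/-- The mean curvature of a helicoidal surface in isothermal parameters. -/
theorem meanCurvature_helicoid {p : ℝ × ℝ} (hp : p ∈ dom I) {r : ℝ} (hr : 0 < r)
    (hE : deriv c p.1 ⬝ᵥ deriv c p.1 = r) (hF : deriv c p.1 ⬝ᵥ axisField lam (c p.1) = 0)
    (hG : axisField lam (c p.1) ⬝ᵥ axisField lam (c p.1) = r) :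
    meanCurvature (helicoidalSurface lam c) p =
      (axisField 0 (axisField lam (c p.1)) + deriv (deriv c) p.1) ⬝ᵥ
        crossProduct (deriv c p.1) (axisField lam (c p.1)) / (2 * r ^ 2) := by
  have hN : crossProduct (deriv c p.1) (axisField lam (c p.1)) ⬝ᵥ
      crossProduct (deriv c p.1) (axisField lam (c p.1)) = r ^ 2 := by
    rw [cross_dot_cross, hE, hG, hF, dotProduct_comm (axisField lam (c p.1)), hF]; ring
  rw [meanCurvature, gaussMap, fffE_helicoid hI hc hp, fffF_helicoid hI hc hp,
    fffG_helicoid hI hc hp, normalVec_helicoid hI hc hp, dV_dV_helicoid hI hc hp,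
    dV_dU_helicoid hI hc hp, dU_dU_helicoid hI hc hp, screw_zero_dot, hE, hF, hG, hN,
    Real.sqrt_sq hr.le]
  simp only [dotProduct_smul, screw_zero_dot, smul_eq_mul, add_dotProduct]
  field_simp
  ring

end SmoothCurve

/-! ### The profile of a cmc helicoid -/

/-- The conformal factor `ρ` of a helicoidal surface with constant mean curvature `H` and constant
Hopf differential of squared modulus `q` satisfies these differential equations. -/
structure IsProfile (H C q : ℝ) (I : Set ℝ) (ρ ρ' : ℝ → ℝ) : Prop where
  pos : ∀ u ∈ I, 0 < ρ u
  hasDerivAt : ∀ u ∈ I, HasDerivAt ρ (ρ' u) u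
  hasDerivAt' : ∀ u ∈ I, HasDerivAt ρ' (4 * C * ρ u - 2 * q - 6 * H ^ 2 * ρ u ^ 2) u
  energy : ∀ u ∈ I, ρ' u ^ 2 = 4 * C * ρ u ^ 2 - 4 * H ^ 2 * ρ u ^ 3 - 4 * q * ρ u

/-- The squared speed of the screw motion at the generating curve. -/
def speedSq (lam : ℝ) (c : ℝ → Vec3) (u : ℝ) : ℝ := c u 0 ^ 2 + c u 1 ^ 2 + lam ^ 2

def speedSq' (c : ℝ → Vec3) (u : ℝ) : ℝ := 2 * (c u 0 * deriv c u 0 + c u 1 * deriv c u 1)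

theorem axisField_dot_self (lam : ℝ) (c : ℝ → Vec3) (u : ℝ) :
    axisField lam (c u) ⬝ᵥ axisField lam (c u) = speedSq lam c u := by
  simp only [axisField, dotProduct, Fin.sum_univ_three, Matrix.cons_val, speedSq]; ring

theorem cross_smul_eq {X A B : Vec3} {r m : ℝ} (hr : 0 < r) (hA : A ⬝ᵥ A = r) (hB : B ⬝ᵥ B = r)
    (hAB : A ⬝ᵥ B = 0) (hXA : X ⬝ᵥ A = 0) (hXB : X ⬝ᵥ B = 0)
    (hX : X ⬝ᵥ crossProduct A B = m * r ^ 2) : X = m • crossProduct A B := by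
  have hr2 : r ^ 2 ≠ 0 := by positivity
  ext i
  apply mul_left_cancel₀ hr2
  have hN : crossProduct A B ⬝ᵥ crossProduct A B = r ^ 2 := by
    rw [cross_dot_cross, hA, hB, hAB, dotProduct_comm B, hAB]; ring
  -- With `N = A × B` this is `|N|²X - (X·N)N = N × (X × N)`, where `X × N = (X·B)A - (X·A)B`
  -- vanishes.
  have key : r ^ 2 * X i = (X ⬝ᵥ crossProduct A B) * crossProduct A B i := by
    rw [← hN]
    simp only [dotProduct, Fin.sum_univ_three, cross_apply, Matrix.cons_val] at hXA hXB ⊢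
    fin_cases i <;> simp only [Matrix.cons_val, Fin.zero_eta, Fin.mk_one, Fin.reduceFinMk]
    · linear_combination ((A 2 * B 0 - A 0 * B 2) * A 2 - (A 0 * B 1 - A 1 * B 0) * A 1) * hXB -
        ((A 2 * B 0 - A 0 * B 2) * B 2 - (A 0 * B 1 - A 1 * B 0) * B 1) * hXA
    · linear_combination ((A 0 * B 1 - A 1 * B 0) * A 0 - (A 1 * B 2 - A 2 * B 1) * A 2) * hXB -
        ((A 0 * B 1 - A 1 * B 0) * B 0 - (A 1 * B 2 - A 2 * B 1) * B 2) * hXA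
    · linear_combination ((A 1 * B 2 - A 2 * B 1) * A 1 - (A 2 * B 0 - A 0 * B 2) * A 0) * hXB -
        ((A 1 * B 2 - A 2 * B 1) * B 1 - (A 2 * B 0 - A 0 * B 2) * B 0) * hXA
  rw [key, hX]; simp only [Pi.smul_apply, smul_eq_mul]; ring

namespace IsCmcHelicoid

variable {H lam : ℝ} {I : Set ℝ} {c : ℝ → Vec3} (h : IsCmcHelicoid H lam I c)
include h

theorem speed_eq {u : ℝ} (hu : u ∈ I) : deriv c u ⬝ᵥ deriv c u = speedSq lam c u := by
  have hp : (u, (0 : ℝ)) ∈ dom I := ⟨hu, trivial⟩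
  have := (h.isothermal _ hp).1
  rwa [fffE_helicoid h.isOpen h.smooth hp, fffG_helicoid h.isOpen h.smooth hp,
    axisField_dot_self] at this

theorem dot_eq_zero {u : ℝ} (hu : u ∈ I) : deriv c u ⬝ᵥ axisField lam (c u) = 0 := by
  have hp : (u, (0 : ℝ)) ∈ dom I := ⟨hu, trivial⟩
  have := (h.isothermal _ hp).2
  rwa [fffF_helicoid h.isOpen h.smooth hp] at this

theorem speedSq_pos {u : ℝ} (hu : u ∈ I) : 0 < speedSq lam c u := by
  have hp : (u, (0 : ℝ)) ∈ dom I := ⟨hu, trivial⟩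
  have hn : 0 ≤ speedSq lam c u := by unfold speedSq; positivity
  refine lt_of_le_of_ne hn fun h0 => h.immersion _ hp ?_
  have hA := h.speed_eq hu
  rw [← h0, dotProduct_self_eq_zero] at hA
  rw [normalVec_helicoid h.isOpen h.smooth hp]
  simp only [hA, map_zero, LinearMap.zero_apply]
  ext i
  fin_cases i <;> simp [screw]

theorem metric_eq {p : ℝ × ℝ} (hp : p ∈ dom I) :
    fffE (helicoidalSurface lam c) p = speedSq lam c p.1 ∧
      fffF (helicoidalSurface lam c) p = 0 ∧
      fffG (helicoidalSurface lam c) p = speedSq lam c p.1 := by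
  refine ⟨?_, (h.isothermal p hp).2, ?_⟩
  · rw [fffE_helicoid h.isOpen h.smooth hp, h.speed_eq hp.1]
  · rw [fffG_helicoid h.isOpen h.smooth hp, axisField_dot_self]

theorem hasDerivAt_coord {u : ℝ} (hu : u ∈ I) (i : Fin 3) :
    HasDerivAt (fun u => c u i) (deriv c u i) u :=
  hasDerivAt_pi.1 (hasDerivAt_curve h.isOpen h.smooth hu) i

theorem hasDerivAt_coord' {u : ℝ} (hu : u ∈ I) (i : Fin 3) :
    HasDerivAt (fun u => deriv c u i) (deriv (deriv c) u i) u :=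
  hasDerivAt_pi.1 (hasDerivAt_deriv_curve h.isOpen h.smooth hu) i

theorem hasDerivAt_speedSq {u : ℝ} (hu : u ∈ I) :
    HasDerivAt (speedSq lam c) (speedSq' c u) u := by
  refine ((((h.hasDerivAt_coord hu 0).pow 2).add ((h.hasDerivAt_coord hu 1).pow 2)).add_const
    (lam ^ 2)).congr_deriv ?_
  simp only [speedSq']; ring

/-- The equation `Δx = 2H x_u × x_v` of surfaces of constant mean curvature `H`. -/
theorem laplace_eq {u : ℝ} (hu : u ∈ I) :
    axisField 0 (axisField lam (c u)) + deriv (deriv c) u =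
      (2 * H) • crossProduct (deriv c u) (axisField lam (c u)) := by
  have hp : (u, (0 : ℝ)) ∈ dom I := ⟨hu, trivial⟩
  have hr := h.speedSq_pos hu
  have hE := h.speed_eq hu
  have hF := h.dot_eq_zero hu
  have hG := axisField_dot_self lam c u
  -- The Laplacian is normal to the surface: its tangential components vanish by differentiating `E
  -- = G` and `F = 0`. Its normal component is the mean curvature.
  refine cross_smul_eq hr hE hG hF ?_ ?_ ?_
  · have h1 : HasDerivAt (fun u => deriv c u ⬝ᵥ deriv c u)
        (2 * (deriv (deriv c) u ⬝ᵥ deriv c u)) u := by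
      simp only [dotProduct, Fin.sum_univ_three]
      have h0 := h.hasDerivAt_coord' hu 0
      have h1 := h.hasDerivAt_coord' hu 1
      have h2 := h.hasDerivAt_coord' hu 2
      exact (((h0.mul h0).add (h1.mul h1)).add (h2.mul h2)).congr_deriv (by ring)
    have h2 : (fun u => deriv c u ⬝ᵥ deriv c u) =ᶠ[nhds u] speedSq lam c := by
      filter_upwards [h.isOpen.mem_nhds hu] with t ht using h.speed_eq ht
    have h3 := (h1.congr_of_eventuallyEq h2.symm).unique (h.hasDerivAt_speedSq hu)
    simp only [dotProduct, Fin.sum_univ_three, axisField, Matrix.cons_val, speedSq',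
      Pi.add_apply] at h3 ⊢
    linear_combination h3 / 2
  · have h1 : HasDerivAt (fun u => deriv c u ⬝ᵥ axisField lam (c u))
        (deriv (deriv c) u ⬝ᵥ axisField lam (c u)) u := by
      simp only [dotProduct, Fin.sum_univ_three, axisField, Matrix.cons_val]
      have h0 := h.hasDerivAt_coord' hu 0
      have h1 := h.hasDerivAt_coord' hu 1
      have h2 := h.hasDerivAt_coord' hu 2
      have k0 := h.hasDerivAt_coord hu 0
      have k1 := h.hasDerivAt_coord hu 1
      exact (((h0.mul k1.neg).add (h1.mul k0)).add (h2.mul_const lam)).congr_deriv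
        (by simp only [Pi.neg_apply]; ring)
    have h2 : (fun u => deriv c u ⬝ᵥ axisField lam (c u)) =ᶠ[nhds u] fun _ => 0 := by
      filter_upwards [h.isOpen.mem_nhds hu] with t ht using h.dot_eq_zero ht
    have h3 := (h1.congr_of_eventuallyEq h2.symm).unique (hasDerivAt_const u 0)
    simp only [dotProduct, Fin.sum_univ_three, axisField, Matrix.cons_val,
      Pi.add_apply] at h3 ⊢
    linear_combination h3
  · have h1 := h.cmc _ hp
    rw [meanCurvature_helicoid h.isOpen h.smooth hp hr hE hF hG, div_eq_iff (by positivity)] at h1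
    linear_combination h1

/-- The first integral `z' - Hρ`. -/
theorem exists_flux : ∃ a : ℝ, ∀ u ∈ I, deriv c u 2 = H * speedSq lam c u + a := by
  obtain ⟨u₀, hu₀⟩ := h.nonempty
  refine ⟨deriv c u₀ 2 - H * speedSq lam c u₀, fun u hu => ?_⟩
  have hd : ∀ t ∈ I, HasDerivAt (fun t => deriv c t 2 - H * speedSq lam c t) 0 t := by
    intro t ht
    refine ((h.hasDerivAt_coord' ht 2).sub ((h.hasDerivAt_speedSq ht).const_mul H)).congr_deriv ?_
    have := congrFun (h.laplace_eq ht) 2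
    simp only [axisField, cross_apply, Matrix.cons_val, Pi.add_apply, Pi.smul_apply,
      smul_eq_mul] at this
    simp only [speedSq']
    linear_combination this
  have := h.isOpen.is_const_of_deriv_eq_zero h.ordConnected.isPreconnected
    (fun t ht => (hd t ht).differentiableAt.differentiableWithinAt)
    (fun t ht => (hd t ht).deriv) hu hu₀
  linear_combination this

/-- The energy equation is Lagrange's identity for the horizontal parts of `c` and `c'`: the product
of their squared lengths `ρ - λ²` and `ρ - z'²` is `(ρ'/2)²` plus the squared determinant, which `F
= 0` identifies with `(λz')²`. The second-order equation is derived separately from `Δx = 2H x_u ×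
x_v`, so that it also holds where `ρ' = 0`. -/
theorem isProfile {a : ℝ} (ha : ∀ u ∈ I, deriv c u 2 = H * speedSq lam c u + a) :
    IsProfile H (1 - 2 * a * H) (a ^ 2 + lam ^ 2) I (speedSq lam c) (speedSq' c) where
  pos u hu := h.speedSq_pos hu
  hasDerivAt u hu := h.hasDerivAt_speedSq hu
  hasDerivAt' u hu := by
    have hE := h.speed_eq hu
    have hF := h.dot_eq_zero hu
    have hL := h.laplace_eq hu
    have hL0 := congrFun hL 0
    have hL1 := congrFun hL 1
    have hz := ha u hu
    simp only [axisField, cross_apply, Matrix.cons_val, Pi.add_apply, Pi.smul_apply,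
      smul_eq_mul, dotProduct, Fin.sum_univ_three] at hL0 hL1 hE hF
    refine ((((h.hasDerivAt_coord hu 0).mul (h.hasDerivAt_coord' hu 0)).add
      ((h.hasDerivAt_coord hu 1).mul (h.hasDerivAt_coord' hu 1))).const_mul 2).congr_deriv ?_
    have hs : speedSq lam c u = c u 0 ^ 2 + c u 1 ^ 2 + lam ^ 2 := rfl
    generalize speedSq lam c u = r at *
    rw [hz] at hE hF hL0 hL1
    linear_combination 2 * hE + 2 * c u 0 * hL0 + 2 * c u 1 * hL1 + 4 * H * lam * hF
      - (2 - 4 * H * (H * r + a)) * hs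
  energy u hu := by
    have hE := h.speed_eq hu
    have hF := h.dot_eq_zero hu
    have hz := ha u hu
    simp only [axisField, Matrix.cons_val, dotProduct, Fin.sum_univ_three] at hE hF
    have hs : speedSq lam c u = c u 0 ^ 2 + c u 1 ^ 2 + lam ^ 2 := rfl
    simp only [speedSq']
    generalize speedSq lam c u = r at *
    rw [hz] at hE hF
    have h1 : c u 0 ^ 2 + c u 1 ^ 2 = r - lam ^ 2 := by linear_combination -hs
    linear_combination 4 * (c u 0 ^ 2 + c u 1 ^ 2) * hE + 4 * (r - (H * r + a) ^ 2) * h1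
      - 4 * (-(deriv c u 0 * c u 1) + deriv c u 1 * c u 0 - lam * (H * r + a)) * hF

end IsCmcHelicoid

/-! ### Degenerate profiles: cylinders and spheres -/

namespace IsCmcHelicoid

variable {H lam : ℝ} {I : Set ℝ} {c : ℝ → Vec3} (h : IsCmcHelicoid H lam I c)
include h

theorem inCircularCylinder {k : ℝ} (hk : ∀ u ∈ I, speedSq lam c u = k) :
    InCircularCylinder (trace lam I c) := by
  have hR : ∀ u ∈ I, c u 0 ^ 2 + c u 1 ^ 2 = k - lam ^ 2 := fun u hu => by
    rw [← hk u hu, speedSq]; ring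
  obtain ⟨u₀, hu₀⟩ := h.nonempty
  -- If the radius vanished, the curve would lie on the axis. Then `F = 0` reads `λz' = 0` and `E =
  -- G` reads `z'² = λ²`, contradicting `ρ > 0`.
  have hpos : 0 < k - lam ^ 2 := by
    refine lt_of_le_of_ne (by rw [← hR u₀ hu₀]; positivity) fun h0 => ?_
    rw [← h0] at hR
    have hc0 : ∀ u ∈ I, c u 0 = 0 := fun u hu => by nlinarith [hR u hu]
    have hc1 : ∀ u ∈ I, c u 1 = 0 := fun u hu => by nlinarith [hR u hu]
    have hd : ∀ i, (∀ u ∈ I, c u i = 0) → deriv c u₀ i = 0 := fun i hi => by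
      refine ((h.hasDerivAt_coord hu₀ i).congr_of_eventuallyEq (f₁ := fun _ => (0 : ℝ)) ?_).unique
        (hasDerivAt_const _ _)
      filter_upwards [h.isOpen.mem_nhds hu₀] with t ht using (hi t ht).symm
    have h1 := h.speedSq_pos hu₀
    have h2 := h.speed_eq hu₀
    have h3 := h.dot_eq_zero hu₀
    simp only [dotProduct, Fin.sum_univ_three, axisField, Matrix.cons_val, hd 0 hc0,
      hd 1 hc1, hc0 u₀ hu₀, hc1 u₀ hu₀] at h2 h3
    rw [hk u₀ hu₀] at h1 h2
    have h4 : deriv c u₀ 2 * lam = 0 := by linear_combination h3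
    have h5 : k = lam ^ 2 := by linarith
    rcases mul_eq_zero.1 h4 with h6 | h6 <;> simp [h6] at h2 h5 <;> linarith
  refine ⟨√(k - lam ^ 2), Real.sqrt_pos.2 hpos, ?_⟩
  rintro _ ⟨p, hp, rfl⟩
  rw [Real.sq_sqrt hpos.le, ← hR _ hp.1]
  simp only [helicoidalSurface, screw, Matrix.cons_val]
  linear_combination (c p.1 0 ^ 2 + c p.1 1 ^ 2) * Real.sin_sq_add_cos_sq p.2

theorem inSphere (hH : H ≠ 0) (hlam : lam = 0)
    (ha : ∀ u ∈ I, deriv c u 2 = H * speedSq lam c u) : InSphere (trace lam I c) := by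
  have hP := h.isProfile (a := 0) (by simpa using ha)
  subst hlam
  obtain ⟨u₀, hu₀⟩ := h.nonempty
  -- This is the height of the centre. It is constant because `(ρ'/ρ)' = -2H²ρ` when `k = 0`, while
  -- `z' = Hρ`. The energy equation with `C = 1` then gives the radius `1/|H|`.
  set z : ℝ → ℝ := fun u => c u 2 + speedSq' c u / (2 * H * speedSq 0 c u) with hz
  have hzd : ∀ u ∈ I, HasDerivAt z 0 u := by
    intro u hu
    have hp := hP.pos u hu
    refine ((h.hasDerivAt_coord hu 2).add ((hP.hasDerivAt' u hu).div
      ((hP.hasDerivAt u hu).const_mul (2 * H)) (by positivity))).congr_deriv ?_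
    have he := hP.energy u hu
    have := ha u hu
    rw [this]
    field_simp
    linear_combination -he
  have hzc : ∀ u ∈ I, z u = z u₀ := fun u hu =>
    h.isOpen.is_const_of_deriv_eq_zero h.ordConnected.isPreconnected
      (fun t ht => (hzd t ht).differentiableAt.differentiableWithinAt)
      (fun t ht => (hzd t ht).deriv) hu hu₀
  refine ⟨![0, 0, z u₀], 1 / |H|, by positivity, ?_⟩
  rintro _ ⟨p, hp, rfl⟩
  have hpos := hP.pos _ hp.1
  have he := hP.energy _ hp.1
  have h1 : c p.1 2 - z u₀ = -(speedSq' c p.1 / (2 * H * speedSq 0 c p.1)) := by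
    rw [← hzc _ hp.1, hz]; ring
  have h2 : (c p.1 2 - z u₀) ^ 2 = 1 / H ^ 2 - speedSq 0 c p.1 := by
    rw [h1, neg_sq, div_pow, he]; field_simp; ring
  have h3 : speedSq 0 c p.1 = c p.1 0 ^ 2 + c p.1 1 ^ 2 + 0 ^ 2 := rfl
  rw [div_pow, sq_abs, one_pow]
  simp only [helicoidalSurface, screw, dotProduct, Fin.sum_univ_three, Matrix.cons_val,
    Pi.sub_apply]
  linear_combination (c p.1 0 ^ 2 + c p.1 1 ^ 2) * Real.sin_sq_add_cos_sq p.2 + h2 - h3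

end IsCmcHelicoid

/-- Converse of `laplace_eq`: paired with `x_u × x_v`, of squared length `ρ²`, the vector equation
returns the mean curvature `H`. -/
theorem isCmcHelicoid_of_laplace {H lam : ℝ} {I : Set ℝ} {c : ℝ → Vec3} (hI : IsOpen I)
    (hoc : I.OrdConnected) (hne : I.Nonempty) (hc : ContDiffOn ℝ ∞ c I)
    (hpos : ∀ u ∈ I, 0 < speedSq lam c u)
    (hE : ∀ u ∈ I, deriv c u ⬝ᵥ deriv c u = speedSq lam c u)
    (hF : ∀ u ∈ I, deriv c u ⬝ᵥ axisField lam (c u) = 0)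
    (hL : ∀ u ∈ I, axisField 0 (axisField lam (c u)) + deriv (deriv c) u =
      (2 * H) • crossProduct (deriv c u) (axisField lam (c u))) :
    IsCmcHelicoid H lam I c where
  isOpen := hI
  ordConnected := hoc
  nonempty := hne
  smooth := hc
  isothermal p hp := by
    rw [fffE_helicoid hI hc hp, fffF_helicoid hI hc hp, fffG_helicoid hI hc hp,
      axisField_dot_self]
    exact ⟨hE _ hp.1, hF _ hp.1⟩
  immersion p hp := by
    intro h0
    have h1 := screw_zero_dot p.2 (crossProduct (deriv c p.1) (axisField lam (c p.1)))
      (crossProduct (deriv c p.1) (axisField lam (c p.1)))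
    rw [← normalVec_helicoid hI hc hp, h0, cross_dot_cross, hE _ hp.1, hF _ hp.1,
      axisField_dot_self] at h1
    simp only [dotProduct_zero, zero_mul, sub_zero] at h1
    have := hpos _ hp.1
    nlinarith
  cmc p hp := by
    have hp0 := hpos _ hp.1
    rw [meanCurvature_helicoid hI hc hp hp0 (hE _ hp.1) (hF _ hp.1)
      (axisField_dot_self _ _ _), hL _ hp.1, smul_dotProduct, cross_dot_cross, hE _ hp.1,
      hF _ hp.1, axisField_dot_self, smul_eq_mul]
    field_simp
    ring

/-! ### The explicit family -/

/-- The horizontal component of the Gauss map along the generating curve. -/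
def gaussHor (q : ℝ × ℝ) (u : ℝ) : ℂ := Complex.exp (Complex.I * (angle q u : ℂ)) * normalHor q u

/-- The horizontal component of the companion curve, rotated by the angle. -/
def compHor (q : ℝ × ℝ) (u : ℝ) : ℂ :=
  Complex.exp (Complex.I * (angle q u : ℂ)) * companionHor q u

theorem profileHor_eq (q : ℝ × ℝ) (u : ℝ) : profileHor q u = gaussHor q u + compHor q u :=
  mul_add _ _ _

section Family

variable {q : ℝ × ℝ} (hq : q ∈ paramSet)
include hq

theorem cOne_sq : cOne q ^ 2 = (1 - q.1 ^ 2 * q.2 ^ 2) * (q.2 ^ 2 - 1) := by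
  obtain ⟨h0, h1, h2, h3⟩ := hq
  refine Real.sq_sqrt (mul_nonneg ?_ ?_)
  · nlinarith [mul_nonneg h0 (zero_le_one.trans h2)]
  · nlinarith

omit hq in
theorem cOne_eq_zero (hb : q.1 * q.2 = 1) : cOne q = 0 := by
  rw [cOne, ← mul_pow, hb]; simp

omit hq in
theorem angle_eq_zero (hb : q.1 * q.2 = 1) (u : ℝ) : angle q u = 0 := by
  rw [angle, cOne_eq_zero hb]; simp

theorem prod_lt_one (hb : q.1 * q.2 ≠ 1) : q.1 ^ 2 * q.2 ^ 2 < 1 := by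
  obtain ⟨h0, h1, h2, h3⟩ := hq
  have := lt_of_le_of_ne h3 hb
  nlinarith [mul_nonneg h0 (zero_le_one.trans h2)]

theorem hasDerivAt_sn_mul (u : ℝ) : HasDerivAt (fun u => sn (q.2 * u) q.1)
    (q.2 * (cn (q.2 * u) q.1 * dn (q.2 * u) q.1)) u := by
  have h := (hasDerivAt_sn hq.1 hq.2.1 (q.2 * u)).comp u ((hasDerivAt_id u).const_mul q.2)
  exact h.congr_deriv (by ring)

theorem hasDerivAt_cn_mul (u : ℝ) : HasDerivAt (fun u => cn (q.2 * u) q.1)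
    (-(q.2 * (sn (q.2 * u) q.1 * dn (q.2 * u) q.1))) u := by
  have h := (hasDerivAt_cn hq.1 hq.2.1 (q.2 * u)).comp u ((hasDerivAt_id u).const_mul q.2)
  exact h.congr_deriv (by ring)

theorem hasDerivAt_dn_mul (u : ℝ) : HasDerivAt (fun u => dn (q.2 * u) q.1)
    (-(q.2 * q.1 ^ 2 * (sn (q.2 * u) q.1 * cn (q.2 * u) q.1))) u := by
  have h := (hasDerivAt_dn hq.1 hq.2.1 (q.2 * u)).comp u ((hasDerivAt_id u).const_mul q.2)
  exact h.congr_deriv (by ring)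

theorem normalHor_pos (hb : q.1 * q.2 ≠ 1) (u : ℝ) : 0 < normalHor q u := by
  rw [normalHor, if_neg hb, Real.sqrt_pos]
  have := prod_lt_one hq hb
  have h1 : sn (q.2 * u) q.1 ^ 2 ≤ 1 := Real.sin_sq_le_one _
  have h2 : 0 ≤ q.1 ^ 2 * q.2 ^ 2 := by positivity
  nlinarith [sq_nonneg (sn (q.2 * u) q.1)]

theorem normalHor_sq (u : ℝ) :
    normalHor q u ^ 2 = 1 - q.1 ^ 2 * q.2 ^ 2 * sn (q.2 * u) q.1 ^ 2 := by
  by_cases hb : q.1 * q.2 = 1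
  · rw [normalHor, if_pos hb, cn_sq, ← mul_pow, hb]; ring
  · have := normalHor_pos hq hb u
    rw [normalHor, if_neg hb, Real.sqrt_pos] at this
    rw [normalHor, if_neg hb, Real.sq_sqrt this.le]

theorem hasDerivAt_normalHor (hb : q.1 * q.2 ≠ 1) (u : ℝ) :
    HasDerivAt (normalHor q) (-(q.1 ^ 2 * q.2 ^ 3 * (sn (q.2 * u) q.1 * cn (q.2 * u) q.1 *
      dn (q.2 * u) q.1)) / normalHor q u) u := by
  have hw := normalHor_pos hq hb u
  have heq : normalHor q = fun u => √(1 - q.1 ^ 2 * q.2 ^ 2 * sn (q.2 * u) q.1 ^ 2) := by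
    funext u; rw [normalHor, if_neg hb]
  have hne : 1 - q.1 ^ 2 * q.2 ^ 2 * sn (q.2 * u) q.1 ^ 2 ≠ 0 := by
    rw [← normalHor_sq hq]; positivity
  have h := ((((hasDerivAt_sn_mul hq u).pow 2).const_mul (q.1 ^ 2 * q.2 ^ 2)).const_sub 1).sqrt hne
  rw [heq] at hw ⊢
  refine h.congr_deriv ?_
  simp only [Pi.pow_apply] at hw ⊢
  field_simp
  ring

theorem hasDerivAt_angle (hb : q.1 * q.2 ≠ 1) (u : ℝ) :
    HasDerivAt (angle q) (cOne q / normalHor q u ^ 2) u := by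
  have h := (hasDerivAt_ellipticPi_am hq.1 hq.2.1 (prod_lt_one hq hb) (q.2 * u)).comp u
    ((hasDerivAt_id u).const_mul q.2)
  have hb0 : q.2 ≠ 0 := by have := hq.2.2.1; positivity
  refine (h.const_mul (cOne q / q.2)).congr_deriv ?_
  rw [normalHor_sq hq]
  field_simp

theorem hasDerivAt_exp_angle (hb : q.1 * q.2 ≠ 1) (u : ℝ) :
    HasDerivAt (fun u => Complex.exp (Complex.I * (angle q u : ℂ)))
      (Complex.exp (Complex.I * (angle q u : ℂ)) *
        (Complex.I * ((cOne q / normalHor q u ^ 2 : ℝ) : ℂ))) u :=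
  ((hasDerivAt_angle hq hb u).ofReal_comp.const_mul Complex.I).cexp

/-- With `m = μb sn`, the pair `(gaussHor, compHor)` solves the linear system `ν' = i c₁ν - mκ`, `κ'
= -mν`. Its coefficients are smooth even where `normalHor` vanishes, so everything after these two
lemmas treats `μb = 1` and `μb < 1` alike. -/
theorem hasDerivAt_gaussHor (u : ℝ) : HasDerivAt (gaussHor q)
    (Complex.I * cOne q * gaussHor q u
      - ((q.1 * q.2 * sn (q.2 * u) q.1 : ℝ) : ℂ) * compHor q u) u := by
  by_cases hb : q.1 * q.2 = 1
  · have heq : gaussHor q = fun u => ((cn (q.2 * u) q.1 : ℝ) : ℂ) := by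
      funext u; simp [gaussHor, angle_eq_zero hb, normalHor, hb]
    rw [heq]
    refine (hasDerivAt_cn_mul hq u).ofReal_comp.congr_deriv ?_
    rw [cOne_eq_zero hb, compHor, angle_eq_zero hb, companionHor, if_pos hb, hb]
    simp only [Complex.ofReal_zero, mul_zero, Complex.exp_zero]
    push_cast
    ring
  · have hw := normalHor_pos hq hb u
    have hw' : (normalHor q u : ℂ) ≠ 0 := Complex.ofReal_ne_zero.2 hw.ne'
    have hsq := congrArg (fun x : ℝ => (x : ℂ)) (normalHor_sq hq u)
    refine ((hasDerivAt_exp_angle hq hb u).mul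
      (hasDerivAt_normalHor hq hb u).ofReal_comp).congr_deriv ?_
    rw [gaussHor, compHor, companionHor, if_neg hb]
    push_cast at hsq ⊢
    field_simp
    linear_combination -Complex.I * cOne q * hsq

theorem hasDerivAt_compHor (u : ℝ) : HasDerivAt (compHor q)
    (-((q.1 * q.2 * sn (q.2 * u) q.1 : ℝ) : ℂ) * gaussHor q u) u := by
  by_cases hb : q.1 * q.2 = 1
  · have heq : compHor q = fun u => ((q.2 * dn (q.2 * u) q.1 : ℝ) : ℂ) := by
      funext u; simp [compHor, angle_eq_zero hb, companionHor, hb]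
    rw [heq]
    refine ((hasDerivAt_dn_mul hq u).const_mul q.2).ofReal_comp.congr_deriv ?_
    have hb2 : q.2 * (q.2 * q.1 ^ 2) = 1 := by
      rw [show q.2 * (q.2 * q.1 ^ 2) = (q.1 * q.2) ^ 2 by ring, hb, one_pow]
    rw [gaussHor, angle_eq_zero hb, normalHor, if_pos hb, hb,
      show q.2 * -(q.2 * q.1 ^ 2 * (sn (q.2 * u) q.1 * cn (q.2 * u) q.1)) =
        -(q.2 * (q.2 * q.1 ^ 2) * (sn (q.2 * u) q.1 * cn (q.2 * u) q.1)) by ring, hb2]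
    simp only [Complex.ofReal_zero, mul_zero, Complex.exp_zero]
    push_cast
    ring
  · have hw := normalHor_pos hq hb u
    have hw' : (normalHor q u : ℂ) ≠ 0 := Complex.ofReal_ne_zero.2 hw.ne'
    have hsq := congrArg (fun x : ℝ => (x : ℂ)) (normalHor_sq hq u)
    have hc := congrArg (fun x : ℝ => (x : ℂ)) (cn_sq (k := q.1) (q.2 * u))
    have hd := congrArg (fun x : ℝ => (x : ℂ)) (dn_sq hq.1 hq.2.1 (q.2 * u))
    have hc1 := congrArg (fun x : ℝ => (x : ℂ)) (cOne_sq hq)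
    have heq : compHor q = fun u => Complex.exp (Complex.I * (angle q u : ℂ)) *
        (((q.1 * q.2 : ℝ) : ℂ) *
        (((q.2 * cn (q.2 * u) q.1 * dn (q.2 * u) q.1 : ℝ) : ℂ)
          - Complex.I * ((cOne q * sn (q.2 * u) q.1 : ℝ) : ℂ)) / ((normalHor q u : ℝ) : ℂ)) := by
      funext u; rw [compHor, companionHor, if_neg hb]
    rw [heq]
    have h1 := (((hasDerivAt_cn_mul hq u).const_mul q.2).mul (hasDerivAt_dn_mul hq u)).ofReal_comp
    have h2 := ((hasDerivAt_sn_mul hq u).const_mul (cOne q)).ofReal_comp.const_mul Complex.I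
    refine ((hasDerivAt_exp_angle hq hb u).mul
      (((h1.sub h2).const_mul ((q.1 * q.2 : ℝ) : ℂ)).div
      (hasDerivAt_normalHor hq hb u).ofReal_comp hw')).congr_deriv ?_
    rw [gaussHor]
    simp only [Pi.mul_apply, Pi.sub_apply, Pi.div_apply]
    push_cast at hsq hc hd hc1 ⊢
    generalize (sn (q.2 * u) q.1 : ℂ) = s at *
    generalize (cn (q.2 * u) q.1 : ℂ) = x at *
    generalize (dn (q.2 * u) q.1 : ℂ) = y at *
    generalize (cOne q : ℂ) = k at *
    generalize (normalHor q u : ℂ) = w at *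
    generalize (q.1 : ℂ) = m at *
    generalize (q.2 : ℂ) = b at *
    field_simp
    -- Once the denominators are cleared, the claim is a polynomial identity modulo the expressions
    -- for `w²`, `cn²`, `dn²` and `c₁²`.
    linear_combination m * b * (-(Complex.I * k * b * x * y) * hsq - k ^ 2 * s * Complex.I_sq
      + s * hc1
      + (s * (w ^ 2 + (1 - m ^ 2 * b ^ 2 * s ^ 2)) - b ^ 2 * s * (y ^ 2 + m ^ 2 * x ^ 2)) * hsq
      + (-(1 - m ^ 2 * b ^ 2 * s ^ 2) * b ^ 2 * s + m ^ 2 * b ^ 4 * s * x ^ 2) * hd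
      + (-(1 - m ^ 2 * b ^ 2 * s ^ 2) * b ^ 2 * s * m ^ 2
        + m ^ 2 * b ^ 4 * s * (1 - m ^ 2 * s ^ 2)) * hc)

end Family

/-! ### The explicit curves: quadratic relations, derivatives, conformal factor -/

section Family

variable {q : ℝ × ℝ} (hq : q ∈ paramSet)
include hq

/-- Multiplication by `normalHor` removes the quotient, which makes the formula valid for both
branches of the definition. -/
theorem normalHor_mul_companionHor (u : ℝ) :
    normalHor q u * (companionHor q u).re =
        q.1 * q.2 ^ 2 * (cn (q.2 * u) q.1 * dn (q.2 * u) q.1) ∧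
      normalHor q u * (companionHor q u).im = -(q.1 * q.2 * (cOne q * sn (q.2 * u) q.1)) := by
  have key : (normalHor q u : ℂ) * companionHor q u = ((q.1 * q.2 : ℝ) : ℂ) *
      (((q.2 * cn (q.2 * u) q.1 * dn (q.2 * u) q.1 : ℝ) : ℂ)
        - Complex.I * ((cOne q * sn (q.2 * u) q.1 : ℝ) : ℂ)) := by
    by_cases hb : q.1 * q.2 = 1
    · rw [normalHor, companionHor, if_pos hb, if_pos hb, hb, cOne_eq_zero hb]
      push_cast; ring
    · have hw' : (normalHor q u : ℂ) ≠ 0 := Complex.ofReal_ne_zero.2 (normalHor_pos hq hb u).ne'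
      rw [companionHor, if_neg hb, mul_div_cancel₀ _ hw']
  have hre := congrArg Complex.re key
  have him := congrArg Complex.im key
  simp only [Complex.re_ofReal_mul, Complex.im_ofReal_mul, Complex.sub_re, Complex.sub_im,
    Complex.ofReal_re, Complex.ofReal_im, Complex.I_mul_re, Complex.I_mul_im] at hre him
  exact ⟨by linear_combination hre, by linear_combination him⟩

theorem companionHor_normSq (u : ℝ) : (companionHor q u).re ^ 2 + (companionHor q u).im ^ 2 =
    q.1 ^ 2 * q.2 ^ 2 * (q.2 ^ 2 - sn (q.2 * u) q.1 ^ 2) := by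
  have hd := dn_sq hq.1 hq.2.1 (q.2 * u)
  by_cases hb : q.1 * q.2 = 1
  · rw [companionHor, if_pos hb, Complex.ofReal_re, Complex.ofReal_im]
    linear_combination q.2 ^ 2 * hd - q.2 ^ 2 * (q.1 * q.2 + 1) * hb
  · have hw := normalHor_pos hq hb u
    obtain ⟨h1, h2⟩ := normalHor_mul_companionHor hq u
    have hc := cn_sq (k := q.1) (q.2 * u)
    have hc1 := cOne_sq hq
    have hsq := normalHor_sq hq u
    apply mul_left_cancel₀ (pow_pos hw 2).ne'
    generalize sn (q.2 * u) q.1 = s at *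
    generalize cn (q.2 * u) q.1 = x at *
    generalize dn (q.2 * u) q.1 = y at *
    generalize (companionHor q u).re = k at *
    generalize (companionHor q u).im = l at *
    generalize normalHor q u = w at *
    linear_combination (w * k + q.1 * q.2 ^ 2 * (x * y)) * h1
      + (w * l - q.1 * q.2 * (cOne q * s)) * h2
      + q.1 ^ 2 * q.2 ^ 4 * x ^ 2 * hd + q.1 ^ 2 * q.2 ^ 4 * (1 - q.1 ^ 2 * s ^ 2) * hc
      + q.1 ^ 2 * q.2 ^ 2 * s ^ 2 * hc1
      - q.1 ^ 2 * q.2 ^ 2 * (q.2 ^ 2 - s ^ 2) * hsq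

omit hq in
theorem exp_angle_normSq (q : ℝ × ℝ) (u : ℝ) :
    (Complex.exp (Complex.I * (angle q u : ℂ))).re ^ 2 +
      (Complex.exp (Complex.I * (angle q u : ℂ))).im ^ 2 = 1 := by
  rw [mul_comm, Complex.exp_ofReal_mul_I_re, Complex.exp_ofReal_mul_I_im, Real.cos_sq_add_sin_sq]

/-- The algebraic relations between the Gauss map and the companion curve. -/
theorem gaussHor_compHor_relations (u : ℝ) :
    (gaussHor q u).re ^ 2 + (gaussHor q u).im ^ 2 =
        1 - (q.1 * q.2 * sn (q.2 * u) q.1) ^ 2 ∧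
      (compHor q u).re ^ 2 + (compHor q u).im ^ 2 =
        q.1 ^ 2 * q.2 ^ 4 - (q.1 * q.2 * sn (q.2 * u) q.1) ^ 2 ∧
      (gaussHor q u).re * (compHor q u).re + (gaussHor q u).im * (compHor q u).im =
        q.1 * q.2 ^ 2 * (cn (q.2 * u) q.1 * dn (q.2 * u) q.1) ∧
      (gaussHor q u).re * (compHor q u).im - (gaussHor q u).im * (compHor q u).re =
        -(cOne q * (q.1 * q.2 * sn (q.2 * u) q.1)) := by
  have he := exp_angle_normSq q u
  have hk := companionHor_normSq hq u
  have hw := normalHor_sq hq u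
  obtain ⟨h1, h2⟩ := normalHor_mul_companionHor hq u
  simp only [gaussHor, compHor, Complex.mul_re, Complex.mul_im, Complex.ofReal_re,
    Complex.ofReal_im]
  generalize Complex.exp (Complex.I * (angle q u : ℂ)) = e at *
  generalize companionHor q u = k at *
  generalize normalHor q u = w at *
  refine ⟨?_, ?_, ?_, ?_⟩
  · linear_combination w ^ 2 * he + hw
  · linear_combination (k.re ^ 2 + k.im ^ 2) * he + hk
  · linear_combination w * k.re * he + h1
  · linear_combination w * k.im * he + h2

theorem contDiff_sn_mul : ContDiff ℝ ∞ (fun u => sn (q.2 * u) q.1) :=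
  (contDiff_sn hq.1 hq.2.1).comp (contDiff_const.mul contDiff_id)

/-- Bootstrapping in the coupled linear system, whose coefficients are smooth. -/
theorem contDiff_gaussHor_compHor : ContDiff ℝ ∞ (gaussHor q) ∧ ContDiff ℝ ∞ (compHor q) := by
  have hg := hasDerivAt_gaussHor hq
  have hk := hasDerivAt_compHor hq
  have hs : ContDiff ℝ ∞ (fun u => ((q.1 * q.2 * sn (q.2 * u) q.1 : ℝ) : ℂ)) :=
    Complex.ofRealCLM.contDiff.comp (contDiff_const.mul (contDiff_sn_mul hq))
  rw [contDiff_infty, contDiff_infty, ← forall_and]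
  intro n
  induction n with
  | zero =>
    simp only [Nat.cast_zero, contDiff_zero, continuous_iff_continuousAt]
    exact ⟨fun u => (hg u).continuousAt, fun u => (hk u).continuousAt⟩
  | succ n ih =>
    rw [Nat.cast_succ, contDiff_succ_iff_deriv, contDiff_succ_iff_deriv]
    have hsn := hs.of_le (show (n : WithTop ℕ∞) ≤ ∞ by exact_mod_cast le_top)
    refine ⟨⟨fun u => (hg u).differentiableAt, by simp, ?_⟩,
      ⟨fun u => (hk u).differentiableAt, by simp, ?_⟩⟩
    · rw [funext fun u => (hg u).deriv]
      exact (contDiff_const.mul ih.1).sub (hsn.mul ih.2)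
    · rw [funext fun u => (hk u).deriv]
      exact hsn.neg.mul ih.1

theorem hasDerivAt_profileVert (u : ℝ) : HasDerivAt (profileVert q)
    (-(1 - (q.1 * q.2 * sn (q.2 * u) q.1) ^ 2 +
      q.1 * q.2 ^ 2 * (cn (q.2 * u) q.1 * dn (q.2 * u) q.1))) u := by
  have h1 := ((hasDerivAt_sn_mul hq u).const_mul (q.1 * q.2)).neg
  have h2 := ((hasDerivAt_ellipticE_am hq.1 hq.2.1 (q.2 * u)).comp u
    ((hasDerivAt_id u).const_mul q.2)).const_mul q.2
  have h3 := (hasDerivAt_id u).const_mul (q.2 ^ 2 - 1)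
  refine (h1.add (h3.sub h2)).congr_deriv ?_
  rw [dn_sq hq.1 hq.2.1]
  ring

/-- The derivative of `-2H` times the generating curve. -/
def velocity (q : ℝ × ℝ) (u : ℝ) : Vec3 :=
  ![-(cOne q * (gaussHor q u).im) - q.1 * q.2 * sn (q.2 * u) q.1 * (profileHor q u).re,
    cOne q * (gaussHor q u).re - q.1 * q.2 * sn (q.2 * u) q.1 * (profileHor q u).im,
    -(1 - (q.1 * q.2 * sn (q.2 * u) q.1) ^ 2 +
      q.1 * q.2 ^ 2 * (cn (q.2 * u) q.1 * dn (q.2 * u) q.1))]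

theorem hasDerivAt_profileHor (u : ℝ) :
    HasDerivAt (fun u => (profileHor q u).re) (velocity q u 0) u ∧
      HasDerivAt (fun u => (profileHor q u).im) (velocity q u 1) u := by
  have heq : profileHor q = fun u => gaussHor q u + compHor q u := funext (profileHor_eq q)
  have h := (hasDerivAt_gaussHor hq u).add (hasDerivAt_compHor hq u)
  have h1 := Complex.reCLM.hasFDerivAt.comp_hasDerivAt u h
  have h2 := Complex.imCLM.hasFDerivAt.comp_hasDerivAt u h
  rw [heq]
  refine ⟨h1.congr_deriv ?_, h2.congr_deriv ?_⟩ <;>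
  simp only [velocity, Matrix.cons_val, profileHor_eq, Complex.reCLM_apply, Complex.imCLM_apply,
    Complex.add_re, Complex.add_im, Complex.sub_re, Complex.sub_im, Complex.mul_re,
    Complex.mul_im, Complex.I_re, Complex.I_im, Complex.ofReal_re, Complex.ofReal_im,
    Complex.neg_re, Complex.neg_im] <;> ring

theorem hasDerivAt_genCurve (H u : ℝ) :
    HasDerivAt (genCurve H q) ((-1 / (2 * H)) • velocity q u) u := by
  refine HasDerivAt.const_smul (-1 / (2 * H))
    (f := fun u => ![(profileHor q u).re, (profileHor q u).im, profileVert q u]) ?_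
  rw [hasDerivAt_pi]
  intro i
  fin_cases i
  · exact (hasDerivAt_profileHor hq u).1
  · exact (hasDerivAt_profileHor hq u).2
  · exact hasDerivAt_profileVert hq u

theorem deriv_genCurve (H : ℝ) :
    deriv (genCurve H q) = fun u => (-1 / (2 * H)) • velocity q u :=
  funext fun u => (hasDerivAt_genCurve hq H u).deriv

/-- The derivative of the velocity, in the form of the equation `Δx = 2H x_u × x_v`. -/
theorem hasDerivAt_velocity (u : ℝ) : HasDerivAt (velocity q)
    (![(1 + velocity q u 2) * (profileHor q u).re - cOne q * velocity q u 1,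
      (1 + velocity q u 2) * (profileHor q u).im + cOne q * velocity q u 0,
      -((profileHor q u).re * velocity q u 0 + (profileHor q u).im * velocity q u 1)] : Vec3) u := by
  have hg := hasDerivAt_gaussHor hq u
  have hg1 := Complex.reCLM.hasFDerivAt.comp_hasDerivAt u hg
  have hg2 := Complex.imCLM.hasFDerivAt.comp_hasDerivAt u hg
  have hm := (hasDerivAt_sn_mul hq u).const_mul (q.1 * q.2)
  obtain ⟨hY1, hY2⟩ := hasDerivAt_profileHor hq u
  have hx := hasDerivAt_cn_mul hq u
  have hy := hasDerivAt_dn_mul hq u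
  obtain ⟨r1, r2, r3, r4⟩ := gaussHor_compHor_relations hq u
  have hc := cn_sq (k := q.1) (q.2 * u)
  have hd := dn_sq hq.1 hq.2.1 (q.2 * u)
  have hc1 := cOne_sq hq
  have d0 : HasDerivAt (fun u => velocity q u 0) _ u :=
    (hg2.const_mul (cOne q)).neg.sub (hm.mul hY1)
  have d1 : HasDerivAt (fun u => velocity q u 1) _ u :=
    (hg1.const_mul (cOne q)).sub (hm.mul hY2)
  have d2 : HasDerivAt (fun u => velocity q u 2) _ u :=
    (((hm.pow 2).const_sub 1).add ((hx.mul hy).const_mul (q.1 * q.2 ^ 2))).neg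
  rw [hasDerivAt_pi]
  intro i
  fin_cases i
  · refine d0.congr_deriv ?_
    simp only [velocity, Matrix.cons_val, profileHor_eq, Complex.imCLM_apply,
      Complex.add_re, Complex.add_im, Complex.sub_im, Complex.mul_re,
      Complex.mul_im, Complex.I_re, Complex.I_im, Complex.ofReal_re, Complex.ofReal_im, Fin.zero_eta]
    ring
  · refine d1.congr_deriv ?_
    simp only [velocity, Matrix.cons_val, profileHor_eq, Complex.reCLM_apply,
      Complex.add_re, Complex.add_im, Complex.sub_re, Complex.mul_re,
      Complex.mul_im, Complex.I_re, Complex.I_im, Complex.ofReal_re, Complex.ofReal_im,  Fin.mk_one]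
    ring
  · refine d2.congr_deriv ?_
    simp only [velocity, Matrix.cons_val, profileHor_eq, Complex.add_re, Complex.add_im,
      Fin.reduceFinMk]
    generalize (gaussHor q u).re = p at *
    generalize (gaussHor q u).im = p' at *
    generalize (compHor q u).re = k at *
    generalize (compHor q u).im = k' at *
    generalize sn (q.2 * u) q.1 = s at *
    generalize cn (q.2 * u) q.1 = x at *
    generalize dn (q.2 * u) q.1 = y at *
    generalize q.1 = m at *
    generalize q.2 = b at *
    generalize cOne _ = c1 at *
    linear_combination (-(m * b * s)) * (r1 + r2 + 2 * r3) + c1 * r4 + m * b ^ 3 * s * hd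
      -- The horizontal components follow from the linear system alone; only the vertical one needs
      -- the quadratic relations.
      + m ^ 3 * b ^ 3 * s * hc - m * b * s * hc1

theorem deriv_deriv_genCurve (H u : ℝ) :
    deriv (deriv (genCurve H q)) u = (-1 / (2 * H)) •
    (![(1 + velocity q u 2) * (profileHor q u).re - cOne q * velocity q u 1,
      (1 + velocity q u 2) * (profileHor q u).im + cOne q * velocity q u 0,
      -((profileHor q u).re * velocity q u 0 + (profileHor q u).im * velocity q u 1)] : Vec3) := by
  rw [deriv_genCurve hq]
  exact ((hasDerivAt_velocity hq u).const_smul (-1 / (2 * H))).deriv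

theorem contDiff_genCurve (H : ℝ) : ContDiff ℝ ∞ (genCurve H q) := by
  obtain ⟨hg, hk⟩ := contDiff_gaussHor_compHor hq
  have hY : ContDiff ℝ ∞ (profileHor q) := by
    rw [funext (profileHor_eq q)]; exact hg.add hk
  have hre : ContDiff ℝ ∞ (fun u => (profileHor q u).re) := Complex.reCLM.contDiff.comp hY
  have him : ContDiff ℝ ∞ (fun u => (profileHor q u).im) := Complex.imCLM.contDiff.comp hY
  have hgre : ContDiff ℝ ∞ (fun u => (gaussHor q u).re) := Complex.reCLM.contDiff.comp hg
  have hgim : ContDiff ℝ ∞ (fun u => (gaussHor q u).im) := Complex.imCLM.contDiff.comp hg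
  have hcre : ContDiff ℝ ∞ (fun u => (compHor q u).re) := Complex.reCLM.contDiff.comp hk
  have hcim : ContDiff ℝ ∞ (fun u => (compHor q u).im) := Complex.imCLM.contDiff.comp hk
  have hs := contDiff_sn_mul hq
  have hZ : ContDiff ℝ ∞ (profileVert q) := by
    rw [contDiff_infty_iff_deriv]
    refine ⟨fun u => (hasDerivAt_profileVert hq u).differentiableAt, ?_⟩
    -- The product `cn dn` is traded for the inner product of `gaussHor` and `compHor`, whose
    -- smoothness is already known.
    have heq : deriv (profileVert q) = fun u => -(1 - (q.1 * q.2 * sn (q.2 * u) q.1) ^ 2 +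
        ((gaussHor q u).re * (compHor q u).re + (gaussHor q u).im * (compHor q u).im)) := by
      funext u
      rw [(hasDerivAt_profileVert hq u).deriv, (gaussHor_compHor_relations hq u).2.2.1]
    rw [heq]
    fun_prop
  change ContDiff ℝ ∞ fun u => (-1 / (2 * H)) •
    (![(profileHor q u).re, (profileHor q u).im, profileVert q u] : Vec3)
  refine ContDiff.const_smul _ (contDiff_pi.2 fun i => ?_)
  fin_cases i
  · exact hre
  · exact him
  · exact hZ

/-- The squared distance to the axis, for `-2H` times the generating curve. -/
theorem profileHor_normSq (u : ℝ) : (profileHor q u).re ^ 2 + (profileHor q u).im ^ 2 =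
    1 + q.1 ^ 2 * q.2 ^ 4 - 2 * (q.1 * q.2 * sn (q.2 * u) q.1) ^ 2
      + 2 * (q.1 * q.2 ^ 2 * (cn (q.2 * u) q.1 * dn (q.2 * u) q.1)) := by
  obtain ⟨r1, r2, r3, r4⟩ := gaussHor_compHor_relations hq u
  rw [profileHor_eq, Complex.add_re, Complex.add_im]
  linear_combination r1 + r2 + 2 * r3

/-- The squared pitch is exactly the term that completes the squared distance to the axis to the
square of `b(dn + μ cn)`. -/
theorem speedSq_genCurve (H u : ℝ) : speedSq (pitch H q) (genCurve H q) u =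
    (1 / (4 * H ^ 2)) * (q.2 * (dn (q.2 * u) q.1 + q.1 * cn (q.2 * u) q.1)) ^ 2 := by
  have h := profileHor_normSq hq u
  have hc := cn_sq (k := q.1) (q.2 * u)
  have hd := dn_sq hq.1 hq.2.1 (q.2 * u)
  have hc1 := cOne_sq hq
  have hσ : (-1 / (2 * H)) ^ 2 = 1 / (4 * H ^ 2) := by rw [div_pow]; ring
  simp only [speedSq, genCurve, pitch, Pi.smul_apply, Matrix.cons_val, smul_eq_mul, mul_pow, hσ]
  linear_combination 1 / (4 * H ^ 2) * (h + hc1 - q.2 ^ 2 * hd - q.1 ^ 2 * q.2 ^ 2 * hc)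

theorem isCmcHelicoid_genCurve {H : ℝ} (hH : H ≠ 0) :
    IsCmcHelicoid H (pitch H q) Set.univ (genCurve H q) := by
  have hb : 0 < q.2 := zero_lt_one.trans_le hq.2.2.1
  refine isCmcHelicoid_of_laplace isOpen_univ Set.ordConnected_univ Set.univ_nonempty
    (contDiff_genCurve hq H).contDiffOn ?_ ?_ ?_ ?_
  · intro u _
    rw [speedSq_genCurve hq]
    have := dn_add_cn_pos hq.1 hq.2.1 (q.2 * u)
    positivity
  · intro u _
    have h := profileHor_normSq hq u
    have hc := cn_sq (k := q.1) (q.2 * u)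
    have hd := dn_sq hq.1 hq.2.1 (q.2 * u)
    have hc1 := cOne_sq hq
    obtain ⟨r1, r2, r3, r4⟩ := gaussHor_compHor_relations hq u
    rw [deriv_genCurve hq, speedSq]
    simp only [genCurve, pitch, Pi.smul_apply, Matrix.cons_val, smul_eq_mul, dotProduct,
      Fin.sum_univ_three, velocity, mul_pow]
    rw [profileHor_eq, Complex.add_re, Complex.add_im] at h ⊢
    generalize (gaussHor q u).re = p at *
    generalize (gaussHor q u).im = p' at *
    generalize (compHor q u).re = k at *
    generalize (compHor q u).im = k' at *
    generalize sn (q.2 * u) q.1 = s at *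
    generalize cn (q.2 * u) q.1 = x at *
    generalize dn (q.2 * u) q.1 = y at *
    generalize -1 / (2 * H) = t at *
    generalize q.1 = m at *
    generalize q.2 = b at *
    generalize cOne _ = c1 at *
    linear_combination t ^ 2 * (c1 ^ 2 * r1 + ((m * b * s) ^ 2 - 1) * h
      - 2 * c1 * m * b * s * r4 + (m * b * s) ^ 2 * hc1 + m ^ 2 * b ^ 4 * x ^ 2 * hd
      + m ^ 2 * b ^ 4 * (1 - m ^ 2 * s ^ 2) * hc)
  · intro u _
    obtain ⟨r1, r2, r3, r4⟩ := gaussHor_compHor_relations hq u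
    rw [deriv_genCurve hq]
    simp only [genCurve, pitch, Pi.smul_apply, Matrix.cons_val, smul_eq_mul, dotProduct,
      Fin.sum_univ_three, velocity, axisField]
    rw [profileHor_eq, Complex.add_re, Complex.add_im]
    linear_combination (-1 / (2 * H)) ^ 2 * cOne q * (r1 + r3)
  · intro u _
    rw [deriv_deriv_genCurve hq, deriv_genCurve hq]
    have h2 : 2 * H * (-1 / (2 * H)) = -1 := by field_simp
    ext i
    fin_cases i <;>
    simp only [genCurve, pitch, Pi.smul_apply, Matrix.cons_val, smul_eq_mul, Pi.add_apply,
      axisField, cross_apply, Fin.zero_eta, Fin.mk_one, Fin.reduceFinMk] <;>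
    generalize -1 / (2 * H) = t at *
    · linear_combination (-t * (velocity q u 1 * cOne q - velocity q u 2 * (profileHor q u).re)) * h2
    · linear_combination (t * (velocity q u 2 * (profileHor q u).im + velocity q u 0 * cOne q)) * h2
    · linear_combination (-t * (velocity q u 0 * (profileHor q u).re + velocity q u 1 * (profileHor q u).im)) * h2

end Family

/-! ### Inner radius, the screw axis, and the constants of the explicit profile -/

section Family

variable {q : ℝ × ℝ} (hq : q ∈ paramSet)
include hq

theorem exists_am_eq {θ : ℝ} (hθ : θ ∈ amDom q.1) : ∃ u, am (q.2 * u) q.1 = θ := by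
  have hb : q.2 ≠ 0 := (zero_lt_one.trans_le hq.2.2.1).ne'
  exact ⟨ellipticF θ q.1 / q.2, by rw [mul_div_cancel₀ _ hb, am_ellipticF hq.1 hq.2.1 hθ]⟩

/-- The form is chosen so that the last bracket is nonnegative, which leaves `(1 - μb²)²/(4H²)` as a
lower bound. -/
theorem helicoid_dist_sq (H : ℝ) (p : ℝ × ℝ) :
    helicoid H q p 0 ^ 2 + helicoid H q p 1 ^ 2 =
      1 / (4 * H ^ 2) * ((1 - q.1 * q.2 ^ 2) ^ 2 + 2 * (q.1 * q.2 ^ 2) *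
        (1 + cn (q.2 * p.1) q.1 * dn (q.2 * p.1) q.1 - q.1 * sn (q.2 * p.1) q.1 ^ 2)) := by
  have h := profileHor_normSq hq p.1
  have hσ : (-1 / (2 * H)) ^ 2 = 1 / (4 * H ^ 2) := by rw [div_pow]; ring
  simp only [helicoid, helicoidalSurface, screw, genCurve, Pi.smul_apply, Matrix.cons_val,
    smul_eq_mul]
  rw [← hσ]
  generalize -1 / (2 * H) = t
  linear_combination t ^ 2 * ((profileHor q p.1).re ^ 2 + (profileHor q p.1).im ^ 2) *
    Real.sin_sq_add_cos_sq p.2 + t ^ 2 * h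

theorem one_add_cn_dn_nonneg (u : ℝ) : 0 ≤ 1 + cn u q.1 * dn u q.1 - q.1 * sn u q.1 ^ 2 := by
  have hc := cn_sq (k := q.1) u
  have hd := dn_sq hq.1 hq.2.1 u
  have hs : sn u q.1 ^ 2 ≤ 1 := Real.sin_sq_le_one _
  obtain ⟨h0, h1, -, -⟩ := hq
  have h2 : 0 ≤ 1 - q.1 * sn u q.1 ^ 2 := by nlinarith [sq_nonneg (sn u q.1)]
  have h3 : (cn u q.1 * dn u q.1) ^ 2 ≤ (1 - q.1 * sn u q.1 ^ 2) ^ 2 := by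
    rw [mul_pow, hc, hd]
    -- The difference of the two sides is `(1 - μ)² sn²`.
    nlinarith [mul_nonneg (sq_nonneg (1 - q.1)) (sq_nonneg (sn u q.1))]
  linarith [(abs_le_of_sq_le_sq' h3 h2).1]

theorem innerRadius_eq_zero_iff {H : ℝ} (hH : H ≠ 0) :
    innerRadius (Set.range (helicoid H q)) = 0 ↔ q.1 * q.2 ^ 2 = 1 := by
  set S := (fun p : Vec3 => √(p 0 ^ 2 + p 1 ^ 2)) '' Set.range (helicoid H q) with hS
  have hne : S.Nonempty := (Set.range_nonempty _).image _
  have hβ : 0 ≤ q.1 * q.2 ^ 2 := mul_nonneg hq.1 (sq_nonneg _)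
  constructor
  · intro h
    have hle : √(1 / (4 * H ^ 2) * (1 - q.1 * q.2 ^ 2) ^ 2) ≤ sInf S := by
      refine le_csInf hne ?_
      rintro _ ⟨_, ⟨p, rfl⟩, rfl⟩
      refine Real.sqrt_le_sqrt ?_
      rw [helicoid_dist_sq hq]
      refine mul_le_mul_of_nonneg_left ?_ (by positivity)
      have := mul_nonneg (mul_nonneg zero_le_two hβ) (one_add_cn_dn_nonneg hq (q.2 * p.1))
      linarith
    rw [show sInf S = 0 from h, Real.sqrt_le_iff] at hle
    have h1 : 0 < 1 / (4 * H ^ 2) := by positivity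
    have h2 : (1 - q.1 * q.2 ^ 2) ^ 2 ≤ 0 := by
      by_contra hcon
      have := mul_pos h1 (not_le.1 hcon)
      linarith [hle.2]
    nlinarith
  · intro h
    have hb : BddBelow S := ⟨0, by rintro _ ⟨_, _, rfl⟩; exact Real.sqrt_nonneg _⟩
    have hmem : ∀ u, √(1 / (4 * H ^ 2) * (2 * (1 + cn (q.2 * u) q.1 * dn (q.2 * u) q.1
        - q.1 * sn (q.2 * u) q.1 ^ 2))) ∈ S := by
      intro u
      refine ⟨_, ⟨(u, 0), rfl⟩, ?_⟩
      simp only [helicoid_dist_sq hq, h]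
      congr 2
      ring
    refine le_antisymm ?_ (Real.sInf_nonneg (by rintro _ ⟨_, _, rfl⟩; exact Real.sqrt_nonneg _))
    -- For `μ = 1` the amplitude stays in `(-π/2, π/2)` and the infimum is only approached, as `am →
    -- π/2`. For `μ < 1` it is attained at `am = π`.
    by_cases hμ : q.1 = 1
    · refine le_of_forall_pos_le_add fun ε hε => ?_
      obtain ⟨δ, hδ0, hδ⟩ : ∃ δ, 0 < δ ∧ δ < Real.pi / 2 ∧ δ / |H| ≤ ε := by
        refine ⟨min (ε * |H|) 1, by positivity, ?_, ?_⟩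
        · exact (min_le_right _ _).trans_lt (by linarith [Real.pi_gt_three])
        · rw [div_le_iff₀ (by positivity)]; exact min_le_left _ _
      obtain ⟨u, hu⟩ := exists_am_eq hq (θ := Real.pi / 2 - δ) (by
        rw [hμ, amDom_one]; constructor <;> linarith [Real.pi_pos])
      refine (csInf_le hb (hmem u)).trans ?_
      have hc : cn (q.2 * u) q.1 = Real.sin δ := by rw [cn, hu, Real.cos_pi_div_two_sub]
      have hd : dn (q.2 * u) q.1 = Real.sin δ := by
        have h1 := dn_sq hq.1 hq.2.1 (q.2 * u)
        have h2 := cn_sq (k := q.1) (q.2 * u)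
        have h3 := dn_pos hq.1 hq.2.1 (q.2 * u)
        have h4 := Real.sin_pos_of_pos_of_lt_pi hδ0 (by linarith [Real.pi_pos])
        rw [hμ] at h1 h2 h3 hc ⊢
        rw [hc] at h2
        nlinarith
      have h5 : sn (q.2 * u) q.1 ^ 2 = 1 - Real.sin δ ^ 2 := by
        have h2 := cn_sq (k := q.1) (q.2 * u)
        rw [hc] at h2; linarith
      have h6 := Real.sin_pos_of_pos_of_lt_pi hδ0 (by linarith [Real.pi_pos])
      have h7 := Real.sin_le hδ0.le
      rw [hc, hd, h5, hμ, zero_add]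
      refine le_trans ?_ hδ.2
      rw [Real.sqrt_le_iff, div_pow, sq_abs]
      refine ⟨by positivity, ?_⟩
      have : Real.sin δ ^ 2 ≤ δ ^ 2 := by nlinarith
      calc 1 / (4 * H ^ 2) * (2 * (1 + Real.sin δ * Real.sin δ - 1 * (1 - Real.sin δ ^ 2)))
          = Real.sin δ ^ 2 / H ^ 2 := by field_simp; ring
        _ ≤ _ := by gcongr
    · obtain ⟨u, hu⟩ := exists_am_eq hq (θ := Real.pi) (by rw [amDom_of_ne_one hμ]; trivial)
      refine (csInf_le hb (hmem u)).trans_eq ?_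
      simp [dn, cn, sn, hu]

/-- At `am = π` the generating curve meets the axis. The pitch is nonzero, as `μb² = 1` gives `c₁² =
(1 - μ)(b² - 1) > 0`, so the orbit of this point is the entire axis. -/
theorem containsAxis_of_ne_one {H : ℝ} (hH : H ≠ 0) (h : q.1 * q.2 ^ 2 = 1) (hμ : q.1 ≠ 1) :
    ContainsAxis (Set.range (helicoid H q)) := by
  obtain ⟨u, hu⟩ := exists_am_eq hq (θ := Real.pi) (by rw [amDom_of_ne_one hμ]; trivial)
  have hn := profileHor_normSq hq u
  have hs : sn (q.2 * u) q.1 = 0 := by simp [sn, hu]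
  have hc : cn (q.2 * u) q.1 = -1 := by simp [cn, hu]
  have hd : dn (q.2 * u) q.1 = 1 := by simp [dn, hs]
  rw [hs, hc, hd, show q.1 ^ 2 * q.2 ^ 4 = (q.1 * q.2 ^ 2) ^ 2 by ring, h] at hn
  have hre : (profileHor q u).re = 0 := by nlinarith
  have him : (profileHor q u).im = 0 := by nlinarith
  have hc1 : cOne q ≠ 0 := by
    have h1 := cOne_sq hq
    obtain ⟨h0, h1', h2, h3⟩ := hq
    have hlt : q.1 < 1 := lt_of_le_of_ne h1' hμ
    have h4 : q.1 ^ 2 * q.2 ^ 2 = q.1 := by linear_combination q.1 * h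
    have h5 : 1 < q.2 ^ 2 := by nlinarith [sq_nonneg q.2]
    intro h6
    rw [h6, h4] at h1
    nlinarith
  intro t
  refine ⟨(u, (t - -1 / (2 * H) * profileVert q u) / (-1 / (2 * H) * cOne q)), ?_⟩
  ext i
  fin_cases i <;>
  simp only [helicoid, helicoidalSurface, screw, genCurve, pitch, Pi.smul_apply, Matrix.cons_val,
    smul_eq_mul, hre, him, Fin.zero_eta, Fin.mk_one, Fin.reduceFinMk]
  · ring
  · ring
  · have h2 : -1 / (2 * H) * cOne q ≠ 0 := by
      refine mul_ne_zero (div_ne_zero (by norm_num) ?_) hc1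
      positivity
    rw [mul_div_cancel₀ _ h2]; ring

theorem isProfile_genCurve {H : ℝ} (hH : H ≠ 0) :
    IsProfile H (q.2 ^ 2 * (1 + q.1 ^ 2) / 2) (q.2 ^ 4 * (1 - q.1 ^ 2) ^ 2 / (16 * H ^ 2)) Set.univ
      (speedSq (pitch H q) (genCurve H q)) (speedSq' (genCurve H q)) := by
  have h := (isCmcHelicoid_genCurve hq hH).isProfile
    -- The flux constant is the one for which `1 - 2aH = b²(1 + μ²)/2`.
    (a := 1 / (2 * H) * (1 - q.2 ^ 2 * (1 + q.1 ^ 2) / 2)) fun u _ => by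
      have hc := cn_sq (k := q.1) (q.2 * u)
      have hd := dn_sq hq.1 hq.2.1 (q.2 * u)
      rw [speedSq_genCurve hq, deriv_genCurve hq]
      simp only [velocity, Pi.smul_apply, Matrix.cons_val, smul_eq_mul]
      field_simp
      linear_combination -(4 * q.2 ^ 2 * hd) - 4 * q.1 ^ 2 * q.2 ^ 2 * hc
  convert h using 1
  · field_simp; ring
  · have hc1 := cOne_sq hq
    rw [pitch, mul_pow (-1 / (2 * H)), hc1]
    field_simp
    ring

theorem speedSq'_genCurve {H : ℝ} (hH : H ≠ 0) (u : ℝ) : speedSq' (genCurve H q) u =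
    -(2 * q.2 * (q.1 * sn (q.2 * u) q.1)) * speedSq (pitch H q) (genCurve H q) u := by
  refine ((isProfile_genCurve hq hH).hasDerivAt u trivial).unique ?_
  have h := ((((hasDerivAt_dn_mul hq u).add ((hasDerivAt_cn_mul hq u).const_mul q.1)).const_mul
    q.2).pow 2).const_mul (1 / (4 * H ^ 2))
  rw [show speedSq (pitch H q) (genCurve H q) = _ from funext (speedSq_genCurve hq H)]
  refine h.congr_deriv ?_
  simp only [Pi.add_apply]
  ring

end Family

/-! ### The cylinder `(μ, b) = (0, 1)` and its rulings -/

theorem ellipticF_zero_right (φ : ℝ) : ellipticF φ 0 = φ := by simp [ellipticF]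

theorem ellipticE_zero_right (φ : ℝ) : ellipticE φ 0 = φ := by simp [ellipticE]

theorem am_zero_right (u : ℝ) : am u 0 = u := by
  have := ellipticF_am le_rfl zero_le_one u
  rwa [ellipticF_zero_right] at this

theorem cylinder_mem_paramSet : ((0 : ℝ), (1 : ℝ)) ∈ paramSet := by
  simp [paramSet]

theorem containsLine_cylinder {H : ℝ} (hH : H ≠ 0) :
    ContainsLine (Set.range (helicoid H (0, 1))) := by
  refine ⟨![-1 / (2 * H), 0, 0], ![0, 0, 1], fun h => ?_, fun t => ?_⟩
  · simpa using congrFun h 2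
  · have hc1 : cOne ((0 : ℝ), (1 : ℝ)) = 0 := by simp [cOne]
    have ha : angle ((0 : ℝ), (1 : ℝ)) (2 * H * t) = 0 := by simp [angle, hc1]
    -- For these parameters the generating curve is itself a vertical line, with height `u/(2H)`.
    refine ⟨(2 * H * t, 0), ?_⟩
    ext i
    fin_cases i
    · simp [helicoid, helicoidalSurface, screw, genCurve, profileHor, ha, normalHor, companionHor]
    · simp [helicoid, helicoidalSurface, screw, genCurve, profileHor, ha, normalHor, companionHor]
    · simp [helicoid, helicoidalSurface, screw, genCurve, profileVert, am_zero_right,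
        ellipticE_zero_right]
      field_simp

theorem ContainsAxis.containsLine {S : Set Vec3} (h : ContainsAxis S) : ContainsLine S := by
  refine ⟨0, ![0, 0, 1], fun h => by simpa using congrFun h 2, fun t => ?_⟩
  convert h t using 1
  ext i; fin_cases i <;> simp

/-! ### Comparison of profiles -/

theorem IsProfile.mono {H C k : ℝ} {I J : Set ℝ} {ρ ρ' : ℝ → ℝ} (h : IsProfile H C k J ρ ρ')
    (hIJ : I ⊆ J) : IsProfile H C k I ρ ρ' :=
  ⟨fun u hu => h.pos u (hIJ hu), fun u hu => h.hasDerivAt u (hIJ hu),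
    fun u hu => h.hasDerivAt' u (hIJ hu), fun u hu => h.energy u (hIJ hu)⟩

/-- The constants `C` and `k` have weights 2 and 4 under homotheties; this makes `k/C²` the natural
invariant. -/
theorem IsProfile.rescale {H C k : ℝ} {ρ ρ' : ℝ → ℝ} (h : IsProfile H C k Set.univ ρ ρ')
    {κ : ℝ} (hκ : 0 < κ) (e : ℝ) :
    IsProfile H (κ ^ 2 * C) (κ ^ 4 * k) Set.univ (fun u => κ ^ 2 * ρ (κ * u + e))
      (fun u => κ ^ 3 * ρ' (κ * u + e)) := by
  have ha : ∀ u, HasDerivAt (fun u => κ * u + e) κ u := fun u =>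
    (((hasDerivAt_id u).const_mul κ).add_const e).congr_deriv (mul_one κ)
  refine ⟨fun u _ => mul_pos (pow_pos hκ 2) (h.pos _ trivial), fun u _ => ?_, fun u _ => ?_,
    fun u _ => ?_⟩
  · exact (((h.hasDerivAt (κ * u + e) trivial).comp u (ha u)).const_mul (κ ^ 2)).congr_deriv
      (by ring)
  · exact (((h.hasDerivAt' (κ * u + e) trivial).comp u (ha u)).const_mul (κ ^ 3)).congr_deriv
      (by ring)
  · linear_combination κ ^ 6 * h.energy (κ * u + e) trivial

/-- A nonnegative function with `|f'| ≤ K f` that vanishes at one point vanishes. -/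
theorem eq_zero_of_abs_deriv_le {f f' : ℝ → ℝ} {a b K : ℝ}
    (hf : ∀ t ∈ Set.Icc a b, HasDerivAt f (f' t) t) (h0 : ∀ t ∈ Set.Icc a b, 0 ≤ f t)
    (hK : ∀ t ∈ Set.Icc a b, |f' t| ≤ K * f t) {s t : ℝ} (hs : s ∈ Set.Icc a b)
    (ht : t ∈ Set.Icc a b) (hfs : f s = 0) : f t = 0 := by
  have he : ∀ (m t : ℝ), HasDerivAt (fun t => Real.exp (m * t)) (Real.exp (m * t) * m) t :=
    fun m t => (((hasDerivAt_id t).const_mul m).congr_deriv (mul_one m)).exp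
  have hd : ∀ m, ∀ t ∈ Set.Icc a b, HasDerivAt (fun t => Real.exp (m * t) * f t)
      (Real.exp (m * t) * (m * f t + f' t)) t := fun m t ht =>
    ((he m t).mul (hf t ht)).congr_deriv (by ring)
  have hcont : ∀ m, ContinuousOn (fun t => Real.exp (m * t) * f t) (Set.Icc a b) := fun m t ht =>
    (hd m t ht).continuousAt.continuousWithinAt
  -- The bound on `f'` makes `exp (Kt) f` increasing and `exp (-Kt) f` decreasing, so a zero
  -- propagates to the left and to the right respectively.
  have hmono : MonotoneOn (fun t => Real.exp (K * t) * f t) (Set.Icc a b) := by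
    refine monotoneOn_of_deriv_nonneg (convex_Icc a b) (hcont K)
      (fun t ht => (hd K t (interior_subset ht)).differentiableAt.differentiableWithinAt)
      fun t ht => ?_
    rw [(hd K t (interior_subset ht)).deriv]
    have := abs_le.1 (hK t (interior_subset ht))
    exact mul_nonneg (Real.exp_pos _).le (by linarith)
  have hanti : AntitoneOn (fun t => Real.exp (-K * t) * f t) (Set.Icc a b) := by
    refine antitoneOn_of_deriv_nonpos (convex_Icc a b) (hcont (-K))
      (fun t ht => (hd (-K) t (interior_subset ht)).differentiableAt.differentiableWithinAt)
      fun t ht => ?_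
    rw [(hd (-K) t (interior_subset ht)).deriv]
    have := abs_le.1 (hK t (interior_subset ht))
    exact mul_nonpos_of_nonneg_of_nonpos (Real.exp_pos _).le (by linarith)
  refine le_antisymm ?_ (h0 t ht)
  rcases le_total s t with h | h
  · have := hanti hs ht h
    simp only [hfs, mul_zero] at this
    exact nonpos_of_mul_nonpos_right this (Real.exp_pos _)
  · have := hmono ht hs h
    simp only [hfs, mul_zero] at this
    exact nonpos_of_mul_nonpos_right this (Real.exp_pos _)

/-- Gronwall for `(ρ - σ)² + (ρ' - σ')²`. The second-order equation is essential, since the energy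
equation alone has non-unique solutions at turning points. -/
theorem IsProfile.eq_of_initial {H C k : ℝ} {I : Set ℝ} {ρ ρ' σ σ' : ℝ → ℝ}
    (h₁ : IsProfile H C k I ρ ρ') (h₂ : IsProfile H C k I σ σ') (hI : I.OrdConnected) {s : ℝ}
    (hs : s ∈ I) (h0 : ρ s = σ s) (h0' : ρ' s = σ' s) {t : ℝ} (ht : t ∈ I) : ρ t = σ t := by
  have hsub : Set.Icc (min s t) (max s t) ⊆ I := hI.uIcc_subset hs ht
  have hcont : ContinuousOn (fun x => 4 * C - 6 * H ^ 2 * (ρ x + σ x))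
      (Set.Icc (min s t) (max s t)) := by
    have c1 : ContinuousOn ρ (Set.Icc (min s t) (max s t)) := fun x hx =>
      (h₁.hasDerivAt x (hsub hx)).continuousAt.continuousWithinAt
    have c2 : ContinuousOn σ (Set.Icc (min s t) (max s t)) := fun x hx =>
      (h₂.hasDerivAt x (hsub hx)).continuousAt.continuousWithinAt
    fun_prop
  obtain ⟨K, hK⟩ := isCompact_Icc.exists_bound_of_continuousOn hcont
  have key := eq_zero_of_abs_deriv_le (K := 1 + K)
    (f := fun x => (ρ x - σ x) ^ 2 + (ρ' x - σ' x) ^ 2)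
    (f' := fun x => 2 * ((ρ x - σ x) * (ρ' x - σ' x)) *
      (1 + (4 * C - 6 * H ^ 2 * (ρ x + σ x)))) (a := min s t) (b := max s t) ?_
    (fun x _ => by positivity) ?_ (s := s) (t := t) ⟨min_le_left _ _, le_max_left _ _⟩
    ⟨min_le_right _ _, le_max_right _ _⟩ (by simp [h0, h0'])
  · nlinarith [sq_nonneg (ρ t - σ t), sq_nonneg (ρ' t - σ' t)]
  · intro x hx
    have d1 := (h₁.hasDerivAt x (hsub hx)).sub (h₂.hasDerivAt x (hsub hx))
    have d2 := (h₁.hasDerivAt' x (hsub hx)).sub (h₂.hasDerivAt' x (hsub hx))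
    refine ((d1.pow 2).add (d2.pow 2)).congr_deriv ?_
    simp only [Pi.sub_apply]
    ring
  · intro x hx
    have h3 := hK x hx
    rw [Real.norm_eq_abs] at h3
    rw [abs_mul, mul_comm]
    refine mul_le_mul ?_ ?_ (abs_nonneg _) (by linarith [abs_nonneg (4 * C - 6 * H ^ 2 * (ρ x + σ x))])
    · refine (abs_add_le _ _).trans ?_
      rw [abs_one]; linarith
    · rw [abs_le]
      constructor
      · nlinarith [sq_nonneg (ρ x - σ x + (ρ' x - σ' x))]
      · nlinarith [sq_nonneg (ρ x - σ x - (ρ' x - σ' x))]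

/-! ### Homothetic changes of parameters -/

/-- The change of parameters `(u, v) ↦ (κ u + e, κ v)`. -/
def homothety (κ e : ℝ) (p : ℝ × ℝ) : ℝ × ℝ := (κ * p.1 + e, κ * p.2)

theorem contDiff_homothety (κ e : ℝ) : ContDiff ℝ ∞ (homothety κ e) := by
  unfold homothety; fun_prop

theorem hasFDerivAt_homothety (κ e : ℝ) (p : ℝ × ℝ) :
    HasFDerivAt (homothety κ e) (κ • ContinuousLinearMap.id ℝ (ℝ × ℝ)) p := by
  have h1 : HasFDerivAt (fun p : ℝ × ℝ => κ • p + (e, 0))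
      (κ • ContinuousLinearMap.id ℝ (ℝ × ℝ)) p :=
    ((hasFDerivAt_id p).const_smul κ).add_const _
  convert h1 using 1
  funext p
  simp [homothety, Prod.ext_iff]

theorem dU_comp_homothety {y : ℝ × ℝ → Vec3} {κ e : ℝ} {p : ℝ × ℝ}
    (hy : DifferentiableAt ℝ y (homothety κ e p)) :
    dU (y ∘ homothety κ e) p = κ • dU y (homothety κ e p) := by
  rw [dU, (hy.hasFDerivAt.comp p (hasFDerivAt_homothety κ e p)).fderiv]
  simp only [ContinuousLinearMap.comp_apply, smul_apply,
    ContinuousLinearMap.id_apply, map_smul, dU]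

theorem dV_comp_homothety {y : ℝ × ℝ → Vec3} {κ e : ℝ} {p : ℝ × ℝ}
    (hy : DifferentiableAt ℝ y (homothety κ e p)) :
    dV (y ∘ homothety κ e) p = κ • dV y (homothety κ e p) := by
  rw [dV, (hy.hasFDerivAt.comp p (hasFDerivAt_homothety κ e p)).fderiv]
  simp only [ContinuousLinearMap.comp_apply, smul_apply,
    ContinuousLinearMap.id_apply, map_smul, dV]

section Homothety

variable {y : ℝ × ℝ → Vec3} {κ e : ℝ} (hκ : 0 < κ) (hy : Differentiable ℝ y)
include hy

theorem fff_comp_homothety (p : ℝ × ℝ) :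
    fffE (y ∘ homothety κ e) p = κ ^ 2 * fffE y (homothety κ e p) ∧
      fffF (y ∘ homothety κ e) p = κ ^ 2 * fffF y (homothety κ e p) ∧
      fffG (y ∘ homothety κ e) p = κ ^ 2 * fffG y (homothety κ e p) := by
  simp only [fffE, fffF, fffG, dU_comp_homothety (hy _), dV_comp_homothety (hy _),
    smul_dotProduct, dotProduct_smul, smul_eq_mul]
  refine ⟨?_, ?_, ?_⟩ <;> ring

include hκ

theorem gaussMap_comp_homothety (p : ℝ × ℝ) :
    gaussMap (y ∘ homothety κ e) p = gaussMap y (homothety κ e p) := by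
  have hN : normalVec (y ∘ homothety κ e) p = κ ^ 2 • normalVec y (homothety κ e p) := by
    simp only [normalVec, dU_comp_homothety (hy _), dV_comp_homothety (hy _), map_smul,
      LinearMap.smul_apply, smul_smul, sq]
  rw [gaussMap, gaussMap, hN, smul_dotProduct, dotProduct_smul, smul_smul, smul_eq_mul,
    smul_eq_mul, ← mul_assoc, ← sq, Real.sqrt_mul (by positivity), Real.sqrt_sq (by positivity),
    mul_inv, mul_right_comm, inv_mul_cancel₀ (by positivity), one_mul]

/-- Numerator and denominator both acquire the factor `κ⁴`, and the Gauss map is unchanged. -/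
theorem meanCurvature_comp_homothety (hyU : Differentiable ℝ (dU y))
    (hyV : Differentiable ℝ (dV y)) (p : ℝ × ℝ) :
    meanCurvature (y ∘ homothety κ e) p = meanCurvature y (homothety κ e p) := by
  have hU : dU (y ∘ homothety κ e) = (κ • dU y) ∘ homothety κ e :=
    funext fun p => dU_comp_homothety (hy _)
  have hV : dV (y ∘ homothety κ e) = (κ • dV y) ∘ homothety κ e :=
    funext fun p => dV_comp_homothety (hy _)
  have hUU : dU (dU (y ∘ homothety κ e)) p = κ ^ 2 • dU (dU y) (homothety κ e p) := by
    rw [hU, dU_comp_homothety ((hyU _).const_smul κ), dU, fderiv_const_smul (hyU _), sq,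
      mul_smul]
    rfl
  have hVU : dV (dU (y ∘ homothety κ e)) p = κ ^ 2 • dV (dU y) (homothety κ e p) := by
    rw [hU, dV_comp_homothety ((hyU _).const_smul κ), dV, fderiv_const_smul (hyU _), sq,
      mul_smul]
    rfl
  have hVV : dV (dV (y ∘ homothety κ e)) p = κ ^ 2 • dV (dV y) (homothety κ e p) := by
    rw [hV, dV_comp_homothety ((hyV _).const_smul κ), dV, fderiv_const_smul (hyV _), sq,
      mul_smul]
    rfl
  obtain ⟨hE, hF, hG⟩ := fff_comp_homothety (κ := κ) (e := e) hy p
  simp only [meanCurvature, hE, hF, hG, hUU, hVU, hVV, gaussMap_comp_homothety hκ hy,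
    smul_dotProduct, smul_eq_mul]
  symm
  rw [← mul_div_mul_left _ _ (pow_pos hκ 4).ne']
  congr 1 <;> ring

end Homothety

/-! ### Existence of associated helicoids -/

theorem differentiable_helicoidalSurface (lam : ℝ) {c : ℝ → Vec3} (hc : Differentiable ℝ c) :
    Differentiable ℝ (helicoidalSurface lam c) :=
  fun _ => differentiableAt_helicoidalSurface lam (hc _)

section Family

variable {q : ℝ × ℝ} (hq : q ∈ paramSet)
include hq

theorem differentiable_helicoid (H : ℝ) : Differentiable ℝ (helicoid H q) :=
  differentiable_helicoidalSurface _ ((contDiff_genCurve hq H).differentiable (by simp))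

theorem differentiable_dU_helicoid (H : ℝ) : Differentiable ℝ (dU (helicoid H q)) := by
  have h := (contDiff_genCurve hq H).contDiffOn (s := Set.univ)
  rw [show dU (helicoid H q) = helicoidalSurface 0 (deriv (genCurve H q)) from
    funext fun p => (dU_helicoid isOpen_univ h ⟨trivial, trivial⟩)]
  exact differentiable_helicoidalSurface _ fun u =>
    (hasDerivAt_deriv_curve isOpen_univ h trivial).differentiableAt

theorem differentiable_dV_helicoid (H : ℝ) : Differentiable ℝ (dV (helicoid H q)) := by
  have h := (contDiff_genCurve hq H).contDiffOn (s := Set.univ)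
  rw [show dV (helicoid H q) = helicoidalSurface 0 (fun u => axisField (pitch H q) (genCurve H q u))
    from funext fun p => (dV_helicoid isOpen_univ h ⟨trivial, trivial⟩)]
  refine differentiable_helicoidalSurface _ fun u => differentiableAt_pi.2 fun i => ?_
  have hd := hasDerivAt_pi.1 (hasDerivAt_curve isOpen_univ h (Set.mem_univ u))
  fin_cases i
  · exact (hd 1).differentiableAt.neg
  · exact (hd 0).differentiableAt
  · exact differentiableAt_const _

omit hq in
-- The angle is the argument of `a + ib`. For `μ = 1` it must lie in `(-π/2, π/2)`, hence the
-- condition `a > 0`.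
theorem exists_angle {μ a b : ℝ} (hμ : 0 ≤ μ) (h : a ^ 2 + b ^ 2 = μ ^ 2) (ha : μ = 1 → 0 < a) :
    ∃ θ ∈ amDom μ, μ * Real.cos θ = a ∧ μ * Real.sin θ = b := by
  have hn : ‖(⟨a, b⟩ : ℂ)‖ = μ := by
    rw [Complex.norm_eq_sqrt_sq_add_sq, h, Real.sqrt_sq hμ]
  refine ⟨Complex.arg ⟨a, b⟩, fun h1 => ?_, ?_, ?_⟩
  · exact Complex.abs_arg_lt_pi_div_two_iff.2 (Or.inl (ha h1))
  · have := Complex.norm_mul_cos_arg ⟨a, b⟩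
    rwa [hn] at this
  · have := Complex.norm_mul_sin_arg ⟨a, b⟩
    rwa [hn] at this

/-- The profile of the explicit helicoid assumes all initial values allowed by the energy. -/
theorem exists_initial {H : ℝ} (hH : H ≠ 0) {r r' : ℝ} (hr : 0 < r)
    (he : r' ^ 2 = 4 * (q.2 ^ 2 * (1 + q.1 ^ 2) / 2) * r ^ 2 - 4 * H ^ 2 * r ^ 3
      - 4 * (q.2 ^ 4 * (1 - q.1 ^ 2) ^ 2 / (16 * H ^ 2)) * r) :
    ∃ u, speedSq (pitch H q) (genCurve H q) u = r ∧ speedSq' (genCurve H q) u = r' := by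
  have hb : 0 < q.2 := zero_lt_one.trans_le hq.2.2.1
  have hμ2 : 0 ≤ 1 - q.1 ^ 2 := by
    obtain ⟨h0, h1, -, -⟩ := hq
    nlinarith
  -- Here `y` is the value that `dn + μ cn` must take.
  obtain ⟨y, hy, hyr⟩ : ∃ y, 0 < y ∧ r = (q.2 * y) ^ 2 / (4 * H ^ 2) := by
    have h1 : 0 < |H| := abs_pos.2 hH
    refine ⟨2 * |H| * √r / q.2, by positivity, ?_⟩
    rw [mul_div_cancel₀ _ hb.ne', mul_pow, mul_pow, Real.sq_sqrt hr.le, sq_abs]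
    field_simp
    ring
  -- Since `(dn + μ cn)(dn - μ cn) = 1 - μ²`, the value `y` determines both `dn` and `μ cn`, and `ρ'
  -- = -2bμ sn ρ` determines `μ sn`. The energy equation says exactly that `(μ cn)² + (μ sn)² = μ²`.
  obtain ⟨θ, hθ, hcos, hsin⟩ := exists_angle (μ := q.1)
    (a := (y - (1 - q.1 ^ 2) / y) / 2) (b := -r' / (2 * r * q.2)) hq.1 (by
      have h2 : (-r' / (2 * r * q.2)) ^ 2 = (1 + q.1 ^ 2) / 2 - y ^ 2 / 4
          - (1 - q.1 ^ 2) ^ 2 / (4 * y ^ 2) := by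
        rw [div_pow, neg_sq, he, hyr]
        field_simp
        ring
      rw [h2]
      field_simp
      ring) (fun h1 => by rw [h1]; simp [hy])
  obtain ⟨u, hu⟩ := exists_am_eq hq hθ
  have hd : dn (q.2 * u) q.1 = (y + (1 - q.1 ^ 2) / y) / 2 := by
    have h1 := dn_sq hq.1 hq.2.1 (q.2 * u)
    have h2 := dn_pos hq.1 hq.2.1 (q.2 * u)
    have h3 : 0 < (y + (1 - q.1 ^ 2) / y) / 2 := by positivity
    have h4 : q.1 ^ 2 * sn (q.2 * u) q.1 ^ 2 = q.1 ^ 2 - (q.1 * Real.cos θ) ^ 2 := by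
      rw [sn, hu, Real.sin_sq]; ring
    have h5 : dn (q.2 * u) q.1 ^ 2 = ((y + (1 - q.1 ^ 2) / y) / 2) ^ 2 := by
      rw [h1, h4, hcos]; field_simp; ring
    exact (pow_left_inj₀ h2.le h3.le two_ne_zero).1 h5
  have h6 : speedSq (pitch H q) (genCurve H q) u = r := by
    rw [speedSq_genCurve hq, hd, cn, hu, hcos, hyr]
    field_simp
    ring
  refine ⟨u, h6, ?_⟩
  rw [speedSq'_genCurve hq hH, h6, sn, hu, hsin]
  field_simp

/-- The homothety with ratio `κ` matches the constants, and its translation `e` matches the initial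
values at one point. Uniqueness for the profile equation then matches the metrics everywhere. -/
theorem associated_of_profile {H lam C k : ℝ} (hH : H ≠ 0) {I : Set ℝ} {c : ℝ → Vec3}
    (h : IsCmcHelicoid H lam I c) (hP : IsProfile H C k I (speedSq lam c) (speedSq' c))
    {κ : ℝ} (hκ : 0 < κ) (hC : C = κ ^ 2 * (q.2 ^ 2 * (1 + q.1 ^ 2) / 2))
    (hk : k = κ ^ 4 * (q.2 ^ 4 * (1 - q.1 ^ 2) ^ 2 / (16 * H ^ 2))) :
    InAssociatedFamily H q lam I c := by
  obtain ⟨u₀, hu₀⟩ := h.nonempty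
  have hP2 := isProfile_genCurve hq hH
  obtain ⟨w, hw, hw'⟩ := exists_initial hq hH (r := speedSq lam c u₀ / κ ^ 2)
    (r' := speedSq' c u₀ / κ ^ 3) (div_pos (hP.pos u₀ hu₀) (pow_pos hκ 2)) (by
      have := hP.energy u₀ hu₀
      rw [hC, hk] at this
      rw [div_pow, this]
      field_simp)
  have hκ2 : κ * u₀ + (w - κ * u₀) = w := by ring
  have hρ : ∀ u ∈ I, speedSq lam c u =
      κ ^ 2 * speedSq (pitch H q) (genCurve H q) (κ * u + (w - κ * u₀)) := fun u hu => by
    have hR := (hP2.rescale hκ (w - κ * u₀)).mono (Set.subset_univ I)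
    rw [← hC, ← hk] at hR
    refine hP.eq_of_initial hR h.ordConnected hu₀ ?_ ?_ hu
    · simp only [hκ2, hw]; field_simp
    · simp only [hκ2, hw']; field_simp
  refine ⟨hq, homothety κ (w - κ * u₀), (contDiff_homothety _ _).contDiffOn,
    fun _ _ => trivial, fun p hp => ?_⟩
  have hy := isCmcHelicoid_genCurve hq hH
  have hpu : homothety κ (w - κ * u₀) p ∈ dom Set.univ := ⟨trivial, trivial⟩
  obtain ⟨hE, hF, hG⟩ := fff_comp_homothety (κ := κ) (e := w - κ * u₀)
    (differentiable_helicoid hq H) p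
  obtain ⟨hE1, hF1, hG1⟩ := h.metric_eq hp
  obtain ⟨hE2, hF2, hG2⟩ := hy.metric_eq hpu
  rw [hE, hF, hG, hE1, hF1, hG1, hρ p.1 hp.1,
    meanCurvature_comp_homothety hκ (differentiable_helicoid hq H)
      (differentiable_dU_helicoid hq H) (differentiable_dV_helicoid hq H), h.cmc p hp]
  refine ⟨?_, ?_, ?_, hy.cmc _ hpu⟩
  · rw [show fffE (helicoid H q) _ = _ from hE2]; rfl
  · rw [show fffF (helicoid H q) _ = _ from hF2, mul_zero]
  · rw [show fffG (helicoid H q) _ = _ from hG2]; rfl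

end Family

/-! ### The isometry invariant of a profile -/

theorem IsProfile.hasDerivAt_logDeriv {H C k : ℝ} {I : Set ℝ} {ρ ρ' : ℝ → ℝ}
    (h : IsProfile H C k I ρ ρ') {u : ℝ} (hu : u ∈ I) :
    HasDerivAt (fun u => ρ' u / ρ u) (2 * k / ρ u - 2 * H ^ 2 * ρ u) u := by
  have hp := h.pos u hu
  refine ((h.hasDerivAt' u hu).div (h.hasDerivAt u hu) hp.ne').congr_deriv ?_
  have := h.energy u hu
  field_simp
  linear_combination -this

theorem hasDerivAt_line {g : ℂ → ℂ} {g' z : ℂ} (hg : HasDerivAt g g' z) (w : ℂ) :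
    HasDerivAt (fun t : ℝ => g (z + t * w)) (g' * w) 0 := by
  have h1 : HasDerivAt (fun t : ℂ => z + t * w) w 0 :=
    (((hasDerivAt_id (0 : ℂ)).mul_const w).const_add z).congr_deriv (one_mul w)
  have h2 : HasDerivAt (fun t : ℂ => g (z + t * w)) (g' * w) 0 :=
    HasDerivAt.comp (h₂ := g) 0 (by simpa using hg) h1
  exact HasDerivAt.comp_ofReal (z := 0) (by simpa using h2)

theorem hasDerivAt_line_re {g : ℂ → ℂ} {g' z : ℂ} (hg : HasDerivAt g g' z) (w : ℂ) :
    HasDerivAt (fun t : ℝ => (g (z + t * w)).re) (g' * w).re 0 :=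
  Complex.reCLM.hasFDerivAt.comp_hasDerivAt (0 : ℝ) (hasDerivAt_line hg w)

theorem hasDerivAt_line_im {g : ℂ → ℂ} {g' z : ℂ} (hg : HasDerivAt g g' z) (w : ℂ) :
    HasDerivAt (fun t : ℝ => (g (z + t * w)).im) (g' * w).im 0 :=
  Complex.imCLM.hasFDerivAt.comp_hasDerivAt (0 : ℝ) (hasDerivAt_line hg w)

theorem hasDerivAt_line_comp_re {r : ℝ → ℝ} {r' : ℝ} {g : ℂ → ℂ} {g' z : ℂ}
    (hr : HasDerivAt r r' (g z).re) (hg : HasDerivAt g g' z) (w : ℂ) :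
    HasDerivAt (fun t : ℝ => r (g (z + t * w)).re) (r' * (g' * w).re) 0 :=
  HasDerivAt.comp (h₂ := r) (0 : ℝ) (by simpa using hr) (hasDerivAt_line_re hg w)

theorem hasDerivAt_line_normSq {g : ℂ → ℂ} {g' z : ℂ} (hg : HasDerivAt g g' z) (w : ℂ) :
    HasDerivAt (fun t : ℝ => Complex.normSq (g (z + t * w)))
      (2 * ((g z).re * (g' * w).re + (g z).im * (g' * w).im)) 0 := by
  have h1 := hasDerivAt_line_re hg w
  have h2 := hasDerivAt_line_im hg w
  simp only [Complex.normSq_apply]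
  exact ((h1.mul h1).add (h2.mul h2)).congr_deriv (by simp; ring)

theorem eventually_line {U : Set ℂ} (hU : IsOpen U) {z : ℂ} (hz : z ∈ U) (w : ℂ) :
    ∀ᶠ t : ℝ in nhds 0, z + t * w ∈ U := by
  have hc : ContinuousAt (fun t : ℝ => z + t * w) 0 := by fun_prop
  exact hc.eventually_mem (hU.mem_nhds (by simpa using hz))

theorem hasDerivAt_unique_of_line {E : Type*} [NormedAddCommGroup E] [NormedSpace ℝ E]
    {U : Set ℂ} (hU : IsOpen U) {z : ℂ} (hz : z ∈ U) {w : ℂ} {F G : ℂ → E}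
    (hFG : ∀ z ∈ U, F z = G z) {F' G' : E} (hF : HasDerivAt (fun t : ℝ => F (z + t * w)) F' 0)
    (hG : HasDerivAt (fun t : ℝ => G (z + t * w)) G' 0) : F' = G' := by
  refine hF.unique (hG.congr_of_eventuallyEq ?_)
  filter_upwards [eventually_line hU hz w] with t ht using hFG _ ht

section Conformal

variable {H C k C₂ k₂ : ℝ} {I : Set ℝ} {ρ ρ' σ σ' : ℝ → ℝ} (h₁ : IsProfile H C k I ρ ρ')
  (h₂ : IsProfile H C₂ k₂ Set.univ σ σ') {U : Set ℂ} (hU : IsOpen U) (hUI : ∀ z ∈ U, z.re ∈ I)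
  {f : ℂ → ℂ} (hf : DifferentiableOn ℂ f U)
  (hm : ∀ z ∈ U, ρ z.re = σ (f z).re * Complex.normSq (deriv f z))
include h₁ h₂ hU hUI hf hm

theorem deriv_metric_eq {z : ℂ} (hz : z ∈ U) :
    (ρ' z.re : ℂ) = σ' (f z).re * deriv f z * Complex.normSq (deriv f z) +
      2 * σ (f z).re * (starRingEnd ℂ (deriv f z) * deriv (deriv f) z) := by
  have hfz : HasDerivAt f (deriv f z) z := (hf.differentiableAt (hU.mem_nhds hz)).hasDerivAt
  have hf' := (hf.deriv hU).differentiableAt (hU.mem_nhds hz) |>.hasDerivAt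
  -- The derivatives in the directions 1 and `i` are combined to `∂_u - i∂_v = 2∂_z` of the metric
  -- identity.
  have key : ∀ w : ℂ, _ := fun w => hasDerivAt_unique_of_line hU hz (w := w) hm
    (hasDerivAt_line_comp_re (g := id) (h₁.hasDerivAt z.re (hUI z hz)) (hasDerivAt_id z) w)
    ((hasDerivAt_line_comp_re (h₂.hasDerivAt (f z).re trivial) hfz w).mul
      (hasDerivAt_line_normSq hf' w))
  have k1 := key 1
  have kI := key Complex.I
  simp only [mul_one, Complex.one_re, Complex.ofReal_zero, zero_mul, add_zero, one_mul,
    Complex.mul_I_re, Complex.I_re, Complex.mul_I_im, mul_zero] at k1 kI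
  apply Complex.ext
  · simp only [Complex.add_re, Complex.mul_re, Complex.mul_im, Complex.ofReal_re,
      Complex.ofReal_im, Complex.conj_re, Complex.conj_im, Complex.re_ofNat, Complex.im_ofNat]
    linear_combination k1
  · simp only [Complex.add_im, Complex.mul_re, Complex.mul_im, Complex.ofReal_re,
      Complex.ofReal_im, Complex.conj_re, Complex.conj_im, Complex.re_ofNat, Complex.im_ofNat]
    linear_combination -kI

omit hU hf in
theorem normSq_deriv_pos {z : ℂ} (hz : z ∈ U) : 0 < Complex.normSq (deriv f z) := by
  have h1 := h₁.pos _ (hUI z hz)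
  rw [hm z hz] at h1
  exact pos_of_mul_pos_right h1 (h₂.pos _ trivial).le

theorem logDeriv_metric_eq {z : ℂ} (hz : z ∈ U) :
    ((ρ' z.re / ρ z.re : ℝ) : ℂ) = ((σ' (f z).re / σ (f z).re : ℝ) : ℂ) * deriv f z +
      2 * (deriv (deriv f) z / deriv f z) := by
  have hpos := normSq_deriv_pos h₁ h₂ hUI hm hz
  have hne : deriv f z ≠ 0 := Complex.normSq_pos.1 hpos
  have hne2 : starRingEnd ℂ (deriv f z) ≠ 0 := (map_ne_zero _).2 hne
  have hσ : (σ (f z).re : ℂ) ≠ 0 := Complex.ofReal_ne_zero.2 (h₂.pos _ trivial).ne'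
  rw [Complex.ofReal_div, deriv_metric_eq h₁ h₂ hU hUI hf hm hz, hm z hz]
  push_cast
  rw [Complex.normSq_eq_conj_mul_self]
  field_simp

/-- Taking `∂_u + i∂_v` of the logarithmic identity kills the holomorphic term `f''/f'` and leaves
`(log ρ)'' = (log σ)''|f'|²`. With `(log ρ)'' = 2k/ρ - 2H²ρ` and `ρ = σ|f'|²` the terms in `H²`
cancel. -/
theorem curvature_eq {z : ℂ} (hz : z ∈ U) : k = k₂ * Complex.normSq (deriv f z) ^ 2 := by
  have hfz : HasDerivAt f (deriv f z) z := (hf.differentiableAt (hU.mem_nhds hz)).hasDerivAt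
  have hf1 := hf.deriv hU
  have hf' := hf1.differentiableAt (hU.mem_nhds hz) |>.hasDerivAt
  have hpos := normSq_deriv_pos h₁ h₂ hUI hm hz
  have hne : deriv f z ≠ 0 := Complex.normSq_pos.1 hpos
  have hf'' := ((hf1.deriv hU).differentiableAt (hU.mem_nhds hz)).hasDerivAt.div hf' hne
  have key : ∀ w : ℂ, _ := fun w => hasDerivAt_unique_of_line hU hz (w := w)
    (fun z hz => logDeriv_metric_eq h₁ h₂ hU hUI hf hm hz)
    (hasDerivAt_line_comp_re (g := id) (h₁.hasDerivAt_logDeriv (hUI z hz))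
      (hasDerivAt_id z) w).ofReal_comp
    (((hasDerivAt_line_comp_re (h₂.hasDerivAt_logDeriv (u := (f z).re) trivial) hfz
      w).ofReal_comp.mul (hasDerivAt_line hf' w)).add ((hasDerivAt_line hf'' w).const_mul 2))
  have k1 := key 1
  have kI := key Complex.I
  simp only [mul_one, Complex.one_re, Complex.ofReal_zero, zero_mul, add_zero, one_mul,
    Complex.mul_I_re, Complex.I_re, mul_zero, id_eq] at k1 kI
  generalize (deriv (deriv (deriv f)) z * deriv f z - deriv (deriv f) z * deriv (deriv f) z) /
    deriv f z ^ 2 = X at *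
  have hρ := h₁.pos _ (hUI z hz)
  have hσ := h₂.pos (f z).re trivial
  have hmz := hm z hz
  have hc : (((2 * k / ρ z.re - 2 * H ^ 2 * ρ z.re : ℝ)) : ℂ) =
      (((2 * k₂ / σ (f z).re - 2 * H ^ 2 * σ (f z).re) * Complex.normSq (deriv f z) : ℝ) : ℂ) := by
    have hz2 : starRingEnd ℂ (deriv f z) = (deriv f z).re - (deriv f z).im * Complex.I := by
      apply Complex.ext <;> simp
    rw [Complex.ofReal_mul, Complex.normSq_eq_conj_mul_self, hz2]
    push_cast at k1 kI ⊢
    linear_combination k1 + Complex.I * kI + (((σ' (f z).re : ℂ) / σ (f z).re) *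
      deriv (deriv f) z + 2 * X) * Complex.I_sq
  have hr := Complex.ofReal_injective hc
  rw [hmz] at hr
  generalize Complex.normSq (deriv f z) = m at *
  generalize σ (f z).re = s at *
  field_simp at hr
  nlinarith

theorem energy_invariant (hne : U.Nonempty) : C₂ ^ 2 * k = C ^ 2 * k₂ := by
  obtain ⟨z, hz⟩ := hne
  have hcurv : ∀ z ∈ U, k = k₂ * (Complex.normSq (deriv f z) * Complex.normSq (deriv f z)) :=
    fun z hz => by rw [← sq]; exact curvature_eq h₁ h₂ hU hUI hf hm hz
  have hf' := (hf.deriv hU).differentiableAt (hU.mem_nhds hz) |>.hasDerivAt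
  have hpos := normSq_deriv_pos h₁ h₂ hUI hm hz
  rcases eq_or_ne k₂ 0 with hk2 | hk2
  · rw [hcurv z hz, hk2]; ring
  -- For `k₂ ≠ 0` the relation `k = k₂|f'|⁴` makes `|f'|` constant, hence the conjugate of `f'`
  -- times `f''` vanishes and `ρ' = σ' f' |f'|²`.
  have key : ∀ w : ℂ, _ := fun w => hasDerivAt_unique_of_line hU hz (w := w) hcurv
    (hasDerivAt_const (0 : ℝ) k)
    (((hasDerivAt_line_normSq hf' w).mul (hasDerivAt_line_normSq hf' w)).const_mul k₂)
  have k1 := key 1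
  have kI := key Complex.I
  simp only [mul_one, Complex.ofReal_zero, zero_mul, add_zero, Complex.mul_I_re,
    Complex.mul_I_im] at k1 kI
  have hd := deriv_metric_eq h₁ h₂ hU hUI hf hm hz
  have hm1 : (deriv f z).re * (deriv (deriv f) z).re +
      (deriv f z).im * (deriv (deriv f) z).im = 0 := by
    have h4 : k₂ * Complex.normSq (deriv f z) * 4 ≠ 0 := by positivity
    apply mul_left_cancel₀ h4
    linear_combination -k1
  have hm2 : (deriv f z).re * -(deriv (deriv f) z).im +
      (deriv f z).im * (deriv (deriv f) z).re = 0 := by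
    have h4 : k₂ * Complex.normSq (deriv f z) * 4 ≠ 0 := by positivity
    apply mul_left_cancel₀ h4
    linear_combination -kI
  have hz0 : starRingEnd ℂ (deriv f z) * deriv (deriv f) z = 0 := by
    apply Complex.ext
    · simp only [Complex.mul_re, Complex.conj_re, Complex.conj_im, Complex.zero_re]
      linear_combination hm1
    · simp only [Complex.mul_im, Complex.conj_re, Complex.conj_im, Complex.zero_im]
      linear_combination -hm2
  rw [hz0, mul_zero, add_zero] at hd
  have hn := congrArg Complex.normSq hd
  simp only [map_mul, Complex.normSq_ofReal] at hn
  have e1 := h₁.energy _ (hUI z hz)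
  have e2 := h₂.energy (f z).re trivial
  have hσ := h₂.pos (f z).re trivial
  rw [hm z hz] at e1
  have hkz := hcurv z hz
  generalize Complex.normSq (deriv f z) = m at *
  generalize σ (f z).re = s at *
  -- In the two energy equations the cubic terms agree because `ρ = mσ`, the linear ones because `k
  -- = m²k₂`; what remains is `C = mC₂`.
  have h5 : C * (m ^ 2 * s ^ 2) = m * C₂ * (m ^ 2 * s ^ 2) := by
    linear_combination -e1 / 4 + m ^ 3 * e2 / 4 + hn / 4 + m * s * hkz
  have h6 : C = m * C₂ := mul_right_cancel₀ (by positivity) h5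
  rw [h6, hkz]
  ring

end Conformal

/-! ### Associated surfaces are conformally parametrized -/

theorem chain_rule_metric {y : ℝ × ℝ → Vec3} {φ : ℝ × ℝ → ℝ × ℝ} {p : ℝ × ℝ} {r : ℝ}
    (hy : DifferentiableAt ℝ y (φ p)) (hφ : DifferentiableAt ℝ φ p)
    (hE : fffE y (φ p) = r) (hF : fffF y (φ p) = 0) (hG : fffG y (φ p) = r) :
    fffE (y ∘ φ) p = r * ((fderiv ℝ φ p (1, 0)).1 ^ 2 + (fderiv ℝ φ p (1, 0)).2 ^ 2) ∧
      fffF (y ∘ φ) p = r * ((fderiv ℝ φ p (1, 0)).1 * (fderiv ℝ φ p (0, 1)).1 +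
        (fderiv ℝ φ p (1, 0)).2 * (fderiv ℝ φ p (0, 1)).2) ∧
      fffG (y ∘ φ) p = r * ((fderiv ℝ φ p (0, 1)).1 ^ 2 + (fderiv ℝ φ p (0, 1)).2 ^ 2) := by
  have hsplit : ∀ a : ℝ × ℝ, fderiv ℝ y (φ p) a = a.1 • dU y (φ p) + a.2 • dV y (φ p) := by
    intro a
    rw [dU, dV, ← map_smul, ← map_smul, ← map_add]
    congr 1
    simp
  have hU : dU (y ∘ φ) p = (fderiv ℝ φ p (1, 0)).1 • dU y (φ p) +
      (fderiv ℝ φ p (1, 0)).2 • dV y (φ p) := by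
    rw [dU, fderiv_comp p hy hφ, ContinuousLinearMap.comp_apply, hsplit]
  have hV : dV (y ∘ φ) p = (fderiv ℝ φ p (0, 1)).1 • dU y (φ p) +
      (fderiv ℝ φ p (0, 1)).2 • dV y (φ p) := by
    rw [dV, fderiv_comp p hy hφ, ContinuousLinearMap.comp_apply, hsplit]
  have hF' : dV y (φ p) ⬝ᵥ dU y (φ p) = 0 := by rw [dotProduct_comm]; exact hF
  unfold fffE at hE
  unfold fffF at hF
  unfold fffG at hG
  simp only [fffE, fffF, fffG, hU, hV, add_dotProduct, dotProduct_add, smul_dotProduct,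
    dotProduct_smul, smul_eq_mul, hE, hF, hG, hF']
  refine ⟨?_, ?_, ?_⟩ <;> ring

/-- The real linear map `(a, b) ↦ a + ε b i`. -/
def toComplex (ε : ℝ) : ℝ × ℝ →L[ℝ] ℂ :=
  Complex.ofRealCLM.comp (ContinuousLinearMap.fst ℝ ℝ ℝ) +
    (ε • Complex.I) • Complex.ofRealCLM.comp (ContinuousLinearMap.snd ℝ ℝ ℝ)

theorem toComplex_apply (ε : ℝ) (a : ℝ × ℝ) : toComplex ε a = ⟨a.1, ε * a.2⟩ := by
  apply Complex.ext <;> simp [toComplex]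

/-- Both metrics are conformal to the flat one, so the differential of `φ` is a similarity and its
Jacobian has a sign near a base point. For negative sign the second component of `φ` is reflected,
which does not affect a metric depending on the first component only. -/
theorem invariant_of_associated {H lam C k C₂ k₂ : ℝ} {I : Set ℝ} {c : ℝ → Vec3}
    (h : IsCmcHelicoid H lam I c) (hP : IsProfile H C k I (speedSq lam c) (speedSq' c))
    {lam₂ : ℝ} {c₂ : ℝ → Vec3} (h₂ : IsCmcHelicoid H lam₂ Set.univ c₂)
    (hP₂ : IsProfile H C₂ k₂ Set.univ (speedSq lam₂ c₂) (speedSq' c₂))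
    (ha : Associated (dom I) (helicoidalSurface lam c) Set.univ (helicoidalSurface lam₂ c₂)) :
    C₂ ^ 2 * k = C ^ 2 * k₂ := by
  obtain ⟨φ, hφ, -, hmet⟩ := ha
  have hD : IsOpen (dom I) := isOpen_dom h.isOpen
  have hφd : ∀ p ∈ dom I, DifferentiableAt ℝ φ p := fun p hp =>
    (hφ.differentiableOn (by simp)).differentiableAt (hD.mem_nhds hp)
  have hrel : ∀ p ∈ dom I, _ := fun p hp => by
    have hφp : φ p ∈ dom Set.univ := ⟨trivial, trivial⟩
    obtain ⟨hE2, hF2, hG2⟩ := h₂.metric_eq hφp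
    obtain ⟨hE1, hF1, hG1⟩ := h.metric_eq hp
    obtain ⟨hE, hF, hG⟩ := chain_rule_metric
      (differentiable_helicoidalSurface lam₂ (fun u => (hasDerivAt_curve h₂.isOpen h₂.smooth
        (Set.mem_univ u)).differentiableAt) (φ p)) (hφd p hp) hE2 hF2 hG2
    obtain ⟨mE, mF, mG, -⟩ := hmet p hp
    rw [hE, hE1] at mE
    rw [hF, hF1] at mF
    rw [hG, hG1] at mG
    exact And.intro mE (And.intro mF mG)
  set J : ℝ × ℝ → ℝ := fun p => (fderiv ℝ φ p (1, 0)).1 * (fderiv ℝ φ p (0, 1)).2 -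
    (fderiv ℝ φ p (0, 1)).1 * (fderiv ℝ φ p (1, 0)).2 with hJ
  have hJc : ContinuousOn J (dom I) := by
    have hc := hφ.continuousOn_fderiv_of_isOpen hD (by simp)
    have c1 : ContinuousOn (fun p => fderiv ℝ φ p (1, 0)) (dom I) :=
      hc.clm_apply continuousOn_const
    have c2 : ContinuousOn (fun p => fderiv ℝ φ p (0, 1)) (dom I) :=
      hc.clm_apply continuousOn_const
    exact (c1.fst.mul c2.snd).sub (c2.fst.mul c1.snd)
  have hJsq : ∀ p ∈ dom I, J p ^ 2 =
      ((fderiv ℝ φ p (1, 0)).1 ^ 2 + (fderiv ℝ φ p (1, 0)).2 ^ 2) ^ 2 ∧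
      (fderiv ℝ φ p (0, 1)).1 ^ 2 + (fderiv ℝ φ p (0, 1)).2 ^ 2 =
        (fderiv ℝ φ p (1, 0)).1 ^ 2 + (fderiv ℝ φ p (1, 0)).2 ^ 2 ∧
      0 < (fderiv ℝ φ p (1, 0)).1 ^ 2 + (fderiv ℝ φ p (1, 0)).2 ^ 2 := fun p hp => by
    obtain ⟨mE, mF, mG⟩ := hrel p hp
    have hs := h₂.speedSq_pos (Set.mem_univ (φ p).1)
    have hr := h.speedSq_pos hp.1
    have hF := (mul_eq_zero.1 mF).resolve_left hs.ne'
    have hG := mul_left_cancel₀ hs.ne' (mG.trans mE.symm)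
    rw [← mE] at hr
    refine ⟨?_, hG, pos_of_mul_pos_right hr hs.le⟩
    simp only [hJ]
    linear_combination ((fderiv ℝ φ p (1, 0)).1 ^ 2 + (fderiv ℝ φ p (1, 0)).2 ^ 2) * hG -
      ((fderiv ℝ φ p (1, 0)).1 * (fderiv ℝ φ p (0, 1)).1 +
        (fderiv ℝ φ p (1, 0)).2 * (fderiv ℝ φ p (0, 1)).2) * hF
  obtain ⟨u₀, hu₀⟩ := h.nonempty
  have hp₀ : (u₀, (0 : ℝ)) ∈ dom I := ⟨hu₀, trivial⟩
  have hJ0 : J (u₀, 0) ≠ 0 := fun h0 => by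
    obtain ⟨h1, -, h3⟩ := hJsq _ hp₀
    rw [h0] at h1
    nlinarith
  obtain ⟨ε, hε, hε0⟩ : ∃ ε : ℝ, ε ^ 2 = 1 ∧ 0 < ε * J (u₀, 0) := by
    rcases lt_or_gt_of_ne hJ0 with h1 | h1
    · exact ⟨-1, by norm_num, by linarith⟩
    · exact ⟨1, by norm_num, by linarith⟩
  set U : Set ℂ := Complex.equivRealProdCLM ⁻¹' (dom I ∩ (fun p => ε * J p) ⁻¹' Set.Ioi 0)
  have hU : IsOpen U := (ContinuousOn.isOpen_inter_preimage (continuousOn_const.mul hJc) hD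
    isOpen_Ioi).preimage Complex.equivRealProdCLM.continuous
  set f : ℂ → ℂ := fun z => toComplex ε (φ (Complex.equivRealProdCLM z)) with hf
  have hCR : ∀ z ∈ U, (fderiv ℝ φ (Complex.equivRealProdCLM z) (0, 1)).1 =
      -(ε * (fderiv ℝ φ (Complex.equivRealProdCLM z) (1, 0)).2) ∧
      (fderiv ℝ φ (Complex.equivRealProdCLM z) (0, 1)).2 =
      ε * (fderiv ℝ φ (Complex.equivRealProdCLM z) (1, 0)).1 := fun z hz => by
    obtain ⟨h1, h2, h3⟩ := hJsq _ hz.1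
    have h4 : 0 < ε * J (Complex.equivRealProdCLM z) := hz.2
    have h5 : ε * J (Complex.equivRealProdCLM z) =
        (fderiv ℝ φ (Complex.equivRealProdCLM z) (1, 0)).1 ^ 2 +
        (fderiv ℝ φ (Complex.equivRealProdCLM z) (1, 0)).2 ^ 2 := by
      refine (pow_left_inj₀ h4.le h3.le two_ne_zero).1 ?_
      rw [mul_pow, hε, one_mul, h1]
    simp only [hJ] at h5
    generalize fderiv ℝ φ (Complex.equivRealProdCLM z) (1, 0) = a at *
    generalize fderiv ℝ φ (Complex.equivRealProdCLM z) (0, 1) = b at *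
    -- The Cauchy–Riemann equations appear as a vanishing sum of squares, since `φ_u` and `φ_v` have
    -- equal length and span a parallelogram of area equal to its square.
    have h6 : (b.2 - ε * a.1) ^ 2 + (b.1 + ε * a.2) ^ 2 = 0 := by
      linear_combination h2 - 2 * h5 + (a.1 ^ 2 + a.2 ^ 2) * hε
    constructor
    · nlinarith [sq_nonneg (b.2 - ε * a.1), sq_nonneg (b.1 + ε * a.2)]
    · nlinarith [sq_nonneg (b.2 - ε * a.1), sq_nonneg (b.1 + ε * a.2)]
  have hfr : ∀ z ∈ U, HasFDerivAt f ((toComplex ε).comp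
      ((fderiv ℝ φ (Complex.equivRealProdCLM z)).comp
        (Complex.equivRealProdCLM : ℂ →L[ℝ] ℝ × ℝ))) z := fun z hz =>
    (toComplex ε).hasFDerivAt.comp z ((hφd _ hz.1).hasFDerivAt.comp z
      Complex.equivRealProdCLM.hasFDerivAt)
  have hfc : ∀ z ∈ U, HasDerivAt f
      (toComplex ε (fderiv ℝ φ (Complex.equivRealProdCLM z) (1, 0))) z := fun z hz => by
    obtain ⟨h1, h2⟩ := hCR z hz
    have he1 : Complex.equivRealProdCLM (1 : ℂ) = ((1 : ℝ), (0 : ℝ)) := rfl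
    have heI : Complex.equivRealProdCLM Complex.I = ((0 : ℝ), (1 : ℝ)) := rfl
    have hd := (hfr z hz).fderiv
    have := complexOfReal_hasDerivAt (hfr z hz).differentiableAt (by
      rw [hd]
      simp only [ContinuousLinearMap.comp_apply, ContinuousLinearEquiv.coe_coe, he1, heI,
        toComplex_apply, smul_eq_mul]
      apply Complex.ext
      · simp only [h1, Complex.mul_re, Complex.I_re, Complex.I_im]
        ring
      · simp only [h2, Complex.mul_im, Complex.I_re, Complex.I_im]
        linear_combination (fderiv ℝ φ (Complex.equivRealProdCLM z) (1, 0)).1 * hε)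
    refine this.congr_deriv (Eq.trans (b := fderiv ℝ f z 1) rfl ?_)
    rw [hd]
    simp only [ContinuousLinearMap.comp_apply, ContinuousLinearEquiv.coe_coe, he1]
  refine energy_invariant hP hP₂ hU (fun z hz => hz.1.1) (f := f)
    (fun z hz => (hfc z hz).differentiableAt.differentiableWithinAt) (fun z hz => ?_)
    ⟨⟨u₀, 0⟩, ?_⟩
  · obtain ⟨mE, -, -⟩ := hrel _ hz.1
    have hre : (f z).re = (φ (Complex.equivRealProdCLM z)).1 := by
      simp only [hf, toComplex_apply]
    have : z.re = (Complex.equivRealProdCLM z).1 := rfl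
    rw [(hfc z hz).deriv, hre, toComplex_apply, Complex.normSq_mk, this, ← mE]
    linear_combination (speedSq lam₂ c₂ (φ (Complex.equivRealProdCLM z)).1) *
      (fderiv ℝ φ (Complex.equivRealProdCLM z) (1, 0)).2 ^ 2 * -hε
  · exact ⟨hp₀, hε0⟩

/-! ### The modulus of a cmc helicoid -/

section Modulus

variable {H C k : ℝ} {I : Set ℝ} {ρ ρ' : ℝ → ℝ} (hP : IsProfile H C k I ρ ρ')
include hP

theorem IsProfile.constants_bound (hH : H ≠ 0) (hk : 0 ≤ k) (hI : I.Nonempty) :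
    0 < C ∧ 2 * |H| * √k ≤ C := by
  obtain ⟨u, hu⟩ := hI
  have hpos := hP.pos u hu
  have he := hP.energy u hu
  have h1 : H ^ 2 * ρ u ^ 2 + k ≤ C * ρ u := by
    by_contra hcon
    have : 4 * ρ u * (C * ρ u - (H ^ 2 * ρ u ^ 2 + k)) < 0 :=
      mul_neg_of_pos_of_neg (by linarith) (by linarith)
    nlinarith [sq_nonneg (ρ' u)]
  have hsq := Real.sq_sqrt hk
  have hab := sq_abs H
  -- The energy equation divided by `4ρ` gives `H²ρ² + k ≤ Cρ`; the bound is the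
  -- arithmetic–geometric mean inequality.
  have h2 : 0 < H ^ 2 * ρ u ^ 2 := by positivity
  refine ⟨pos_of_mul_pos_left (by linarith) hpos.le, ?_⟩
  refine le_of_mul_le_mul_right ?_ hpos
  nlinarith [sq_nonneg (|H| * ρ u - √k)]

theorem IsProfile.exists_modulus (hH : H ≠ 0) (hk : 0 ≤ k) (hI : I.Nonempty) :
    ∃ μ s : ℝ, 0 ≤ μ ∧ μ ≤ 1 ∧ 0 < s ∧ C = s * (1 + μ ^ 2) / 2 ∧
      k = s ^ 2 * (1 - μ ^ 2) ^ 2 / (16 * H ^ 2) := by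
  obtain ⟨hC, hle⟩ := hP.constants_bound hH hk hI
  have ht0 : 0 ≤ 2 * |H| * √k := by positivity
  have ht : (2 * |H| * √k) ^ 2 = 4 * H ^ 2 * k := by
    rw [mul_pow, mul_pow, sq_abs, Real.sq_sqrt hk]; ring
  generalize 2 * |H| * √k = t at *
  have hs : 0 < C + t := by linarith
  have hμ : √((C - t) / (C + t)) ^ 2 = (C - t) / (C + t) :=
    Real.sq_sqrt (div_nonneg (by linarith) hs.le)
  -- With `t = 2|H|√k` the requirements read `2C = s(1 + μ²)` and `2t = s(1 - μ²)`; sum and quotient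
  -- give `s` and `μ²`.
  refine ⟨√((C - t) / (C + t)), C + t, Real.sqrt_nonneg _, ?_, hs, ?_, ?_⟩
  · rw [Real.sqrt_le_one, div_le_one hs]; linarith
  · rw [hμ]; field_simp; ring
  · rw [hμ]
    field_simp
    linear_combination -4 * ht

/-- In the equality case the energy equation becomes `H²ρ'² = -ρ(2H²ρ - C)²`, so `ρ` can only be the
double root. -/
theorem IsProfile.eq_const (hH : H ≠ 0) (hCk : C ^ 2 = 4 * H ^ 2 * k) {u : ℝ} (hu : u ∈ I) :
    ρ u = C / (2 * H ^ 2) := by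
  have hpos := hP.pos u hu
  have he := hP.energy u hu
  have h1 : ρ u * (2 * H ^ 2 * ρ u - C) ^ 2 ≤ 0 := by
    have : ρ u * (2 * H ^ 2 * ρ u - C) ^ 2 = -(H ^ 2 * ρ' u ^ 2) := by
      linear_combination ρ u * hCk + H ^ 2 * he
    rw [this]
    exact neg_nonpos.2 (by positivity)
  have h2 : (2 * H ^ 2 * ρ u - C) ^ 2 ≤ 0 := nonpos_of_mul_nonpos_right h1 hpos
  rw [eq_div_iff (by positivity)]
  nlinarith

end Modulus

section

variable {H lam C k : ℝ} {I : Set ℝ} {c : ℝ → Vec3} (hH : H ≠ 0) (h : IsCmcHelicoid H lam I c)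
  (hP : IsProfile H C k I (speedSq lam c) (speedSq' c)) (hk : 0 ≤ k)
include hH h hP

/-- Only `μ` has to fit: whatever `b` is, the ratio `κ = √s/b` compensates for it. -/
theorem inAssociatedFamily_of_modulus {q : ℝ × ℝ} (hq : q ∈ paramSet) {s : ℝ} (hs : 0 < s)
    (hC : C = s * (1 + q.1 ^ 2) / 2) (hkq : k = s ^ 2 * (1 - q.1 ^ 2) ^ 2 / (16 * H ^ 2)) :
    InAssociatedFamily H q lam I c := by
  have hb : 0 < q.2 := zero_lt_one.trans_le hq.2.2.1
  have h2 : (√s / q.2) ^ 2 = s / q.2 ^ 2 := by rw [div_pow, Real.sq_sqrt hs.le]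
  refine associated_of_profile hq hH h hP (κ := √s / q.2) (by positivity) ?_ ?_
  · rw [hC, h2]; field_simp
  · rw [hkq, show (√s / q.2) ^ 4 = ((√s / q.2) ^ 2) ^ 2 by ring, h2]; field_simp

include hk

/-- The invariant `k/C²` yields `(1 + μ²)t = C(1 - μ²)` with `t = 2|H|√k`, after taking the square
root of two nonnegative sides. This determines `μ²`. -/
theorem modulus_of_inAssociatedFamily {q : ℝ × ℝ} (hq : InAssociatedFamily H q lam I c) :
    q.1 ^ 2 * (C + 2 * |H| * √k) = C - 2 * |H| * √k := by
  obtain ⟨hC, -⟩ := hP.constants_bound hH hk h.nonempty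
  obtain ⟨hq, ha⟩ := hq
  have hinv := invariant_of_associated h hP (isCmcHelicoid_genCurve hq hH)
    (isProfile_genCurve hq hH) ha
  have hb : 0 < q.2 := zero_lt_one.trans_le hq.2.2.1
  have ht0 : 0 ≤ 2 * |H| * √k := by positivity
  have ht : (2 * |H| * √k) ^ 2 = 4 * H ^ 2 * k := by
    rw [mul_pow, mul_pow, sq_abs, Real.sq_sqrt hk]; ring
  generalize 2 * |H| * √k = t at *
  have hμ : 0 ≤ 1 - q.1 ^ 2 := by
    obtain ⟨h0, h1, -, -⟩ := hq
    nlinarith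
  have h1 : ((1 + q.1 ^ 2) * t) ^ 2 = (C * (1 - q.1 ^ 2)) ^ 2 := by
    have hb4 : q.2 ^ 4 ≠ 0 := by positivity
    apply mul_left_cancel₀ hb4
    field_simp at hinv
    linear_combination q.2 ^ 4 * (1 + q.1 ^ 2) ^ 2 * ht + q.2 ^ 4 / 4 * hinv
  have h2 := (pow_left_inj₀ (by positivity) (by positivity) two_ne_zero).1 h1
  linear_combination h2

omit hk in
theorem inCircularCylinder_of_modulus_zero {s : ℝ} (hC : C = s * (1 + 0 ^ 2) / 2)
    (hkq : k = s ^ 2 * (1 - 0 ^ 2) ^ 2 / (16 * H ^ 2)) : InCircularCylinder (trace lam I c) := by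
  refine h.inCircularCylinder fun u hu => hP.eq_const hH ?_ hu
  rw [hC, hkq]; field_simp; ring

end

theorem mem_paramSet_of_modulus {μ : ℝ} (h0 : 0 < μ) (h1 : μ ≤ 1) :
    (μ, 1 / √μ) ∈ paramSet ∧ μ * (1 / √μ) ^ 2 = 1 := by
  have hs := Real.sqrt_pos.2 h0
  have hsq := Real.sq_sqrt h0.le
  have hs1 : √μ ≤ 1 := Real.sqrt_le_one.2 h1
  refine ⟨⟨h0.le, h1, ?_, ?_⟩, ?_⟩
  · exact (le_div_iff₀ hs).2 (by linarith)
  · change μ * (1 / √μ) ≤ 1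
    rw [mul_one_div, div_le_one hs]; nlinarith
  · rw [div_pow, hsq]; field_simp

theorem modulus_injective {q q' : ℝ × ℝ} {A B : ℝ} (hA : 0 < A) (hq : q ∈ paramSet)
    (hq' : q' ∈ paramSet) (h1 : q.1 ^ 2 * A = B) (h2 : q'.1 ^ 2 * A = B)
    (h3 : q.1 * q.2 ^ 2 = 1) (h4 : q'.1 * q'.2 ^ 2 = 1) : q = q' := by
  have e1 : q.1 = q'.1 := (pow_left_inj₀ hq.1 hq'.1 two_ne_zero).1
    (mul_right_cancel₀ hA.ne' (h1.trans h2.symm))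
  have hμ : q.1 ≠ 0 := fun h => by rw [h, zero_mul] at h3; exact zero_ne_one h3
  have e2 : q.2 = q'.2 := by
    refine (pow_left_inj₀ (zero_le_one.trans hq.2.2.1) (zero_le_one.trans hq'.2.2.1)
      two_ne_zero).1 (mul_left_cancel₀ hμ ?_)
    rw [h3, e1, h4]
  exact Prod.ext e1 e2

end CmcHelicoid
end

/-! ### Classification of cmc helicoids up to association -/

theorem proposition6p4 (H : ℝ) (hH : H ≠ 0) :
    (∀ q ∈ CmcHelicoid.paramSet,
      CmcHelicoid.IsCmcHelicoid H (CmcHelicoid.pitch H q) Set.univ (CmcHelicoid.genCurve H q) ∧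
      (CmcHelicoid.innerRadius (Set.range (CmcHelicoid.helicoid H q)) = 0 ↔ q.1 * q.2 ^ 2 = 1)) ∧
    ∀ (lam : ℝ) (I : Set ℝ) (c : ℝ → CmcHelicoid.Vec3), CmcHelicoid.IsCmcHelicoid H lam I c →
      (¬ CmcHelicoid.InCircularCylinder (CmcHelicoid.trace lam I c) →
        ∃! q : ℝ × ℝ, CmcHelicoid.InAssociatedFamily H q lam I c ∧ q.1 * q.2 ^ 2 = 1) ∧
      (¬ CmcHelicoid.InSphere (CmcHelicoid.trace lam I c) →
        ∃ q : ℝ × ℝ, CmcHelicoid.InAssociatedFamily H q lam I c ∧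
          CmcHelicoid.ContainsLine (Set.range (CmcHelicoid.helicoid H q))) ∧
      (¬ CmcHelicoid.InCircularCylinder (CmcHelicoid.trace lam I c) →
        ¬ CmcHelicoid.InSphere (CmcHelicoid.trace lam I c) →
          ∀ q : ℝ × ℝ, CmcHelicoid.InAssociatedFamily H q lam I c → q.1 * q.2 ^ 2 = 1 →
            CmcHelicoid.ContainsAxis (Set.range (CmcHelicoid.helicoid H q))) := by
  open CmcHelicoid in
  refine ⟨fun q hq => ⟨isCmcHelicoid_genCurve hq hH, innerRadius_eq_zero_iff hq hH⟩,
    fun lam I c h => ?_⟩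
  obtain ⟨a, ha⟩ := h.exists_flux
  have hP := h.isProfile ha
  have hk : 0 ≤ a ^ 2 + lam ^ 2 := by positivity
  -- Vanishing of `k = a² + λ²` means zero pitch and zero flux constant, which is the case of a
  -- sphere.
  have hsphere : ¬ InSphere (trace lam I c) → a ^ 2 + lam ^ 2 ≠ 0 := fun hns h0 => by
    have ha0 : a = 0 := by nlinarith
    have hl0 : lam = 0 := by nlinarith
    exact hns (h.inSphere hH hl0 fun u hu => by rw [ha u hu, ha0, add_zero])
  generalize a ^ 2 + lam ^ 2 = k at *
  obtain ⟨hC, -⟩ := hP.constants_bound hH hk h.nonempty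
  have hA : 0 < 1 - 2 * a * H + 2 * |H| * √k := add_pos_of_pos_of_nonneg hC (by positivity)
  have haxis : ¬ InSphere (trace lam I c) → ∀ q : ℝ × ℝ, InAssociatedFamily H q lam I c →
      q.1 * q.2 ^ 2 = 1 → ContainsAxis (Set.range (helicoid H q)) := fun hns q hq hqb => by
    -- The modulus `μ = 1` would force `√k = 0`.
    refine containsAxis_of_ne_one hq.1 hH hqb fun h1 => ?_
    have hmod := modulus_of_inAssociatedFamily hH h hP hk hq
    have hpos : 0 < |H| * √k :=
      mul_pos (abs_pos.2 hH) (Real.sqrt_pos.2 (lt_of_le_of_ne hk (hsphere hns).symm))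
    rw [h1] at hmod
    linarith
  obtain ⟨μ, s, hμ0, hμ1, hs, hCs, hks⟩ := hP.exists_modulus hH hk h.nonempty
  have hex : 0 < μ → InAssociatedFamily H (μ, 1 / √μ) lam I c := fun hμ =>
    inAssociatedFamily_of_modulus hH h hP (mem_paramSet_of_modulus hμ hμ1).1 hs hCs hks
  refine ⟨fun hnc => ?_, fun hns => ?_, fun _ => haxis⟩
  · have hμ : 0 < μ := by
      refine lt_of_le_of_ne hμ0 fun h0 => hnc ?_
      subst h0
      exact inCircularCylinder_of_modulus_zero hH h hP hCs hks
    refine ⟨(μ, 1 / √μ), ⟨hex hμ, (mem_paramSet_of_modulus hμ hμ1).2⟩, fun q hq => ?_⟩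
    exact modulus_injective hA hq.1.1 (hex hμ).1 (modulus_of_inAssociatedFamily hH h hP hk hq.1)
      (modulus_of_inAssociatedFamily hH h hP hk (hex hμ)) hq.2 (mem_paramSet_of_modulus hμ hμ1).2
  -- For `μ = 0` no member satisfies `μb² = 1`, and the line is a ruling of the cylinder; otherwise
  -- it is the screw axis.
  · rcases hμ0.eq_or_lt with h0 | hμ
    · subst h0
      exact ⟨(0, 1), inAssociatedFamily_of_modulus hH h hP cylinder_mem_paramSet hs hCs hks,
        containsLine_cylinder hH⟩
    · exact ⟨(μ, 1 / √μ), hex hμ,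
        (haxis hns _ (hex hμ) (mem_paramSet_of_modulus hμ hμ1).2).containsLine⟩
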